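/- Let $0<\alpha<1$ and $\nu>0$. Let $S_\alpha$ be a positive stable random variable with $\mathbb E[e^{-yS_\alpha}]=e^{-y^\alpha}$ for $y\ge 0$, and let $f_\alpha$ be a density of it. Write $$(I^\nu_+f_\alpha)(t)=\frac1{\Gamma(\nu)}\int_0^t f_\alpha(u)(t-u)^{\nu-1}\,du .$$ Let $(\tau_\alpha(y))_{y\ge0}$ be a generalized gamma subordinator, that is, the nondecreasing right-continuous process with $\tau_\alpha(0)=0$ and stationary independent increments with $\mathbb E[e^{-\omega\tau_\alpha(y)}]=e^{-y((1+\omega)^\alpha-1)}$ for $\omega\ge 0$, and let $\tau_\alpha'$ be a process with the same law. Let $G_a$ denote a Gamma$(a,1)$ variable; suppose that $G_\nu$ is independent of $\tau_\alpha$ and that $G_{\nu/\alpha}$, $\tau_\alpha$, $\tau_\alpha'$ are mutually independent. For $\lambda>0$ put $$\tilde S_{\alpha,\nu}(\lambda)=\frac{\tau_\alpha(G_{\nu/\alpha}+\lambda^\alpha)}{\lambda},\qquad f^{(\nu)}_{\alpha,\lambda}(u,s)=\frac{\lambda^\nu u^{\nu-1}e^{-\lambda u}}{\Gamma(\nu)}\;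 e^{\lambda^\alpha}e^{-\lambda s}f_\alpha(s)\qquad(u,s>0).$$ (1) Let $h\ge0$ be a measurable function on $(0,\infty)$ such that $h f_\alpha$ is a probability density on $(0,\infty)$. Then $\mathbb E[h(S_\alpha)]=1$ and, for every $\lambda>0$, as identities in $[0,\infty]$, $$\int_0^\infty e^{-\lambda t}h(t)(I^\nu_+f_\alpha)(t)\,dt=\frac1{\lambda^\nu e^{\lambda^\alpha}}\int_0^\infty\!\!\int_0^\infty h(u+s)f^{(\nu)}_{\alpha,\lambda}(u,s)\,du\,ds$$ $$=\frac1{\lambda^\nu e^{\lambda^\alpha}}\,\mathbb E\Big[h\Big(\frac{G_\nu}{\lambda}+\frac{\tau_\alpha(\lambda^\alpha)}{\lambda}\Big)\Big]=\frac1{\lambda^\nu e^{\lambda^\alpha}}\,\mathbb E\big[h(\tilde S_{\alpha,\nu}(\lambda))\big].$$ (2) For every $\lambda>0$ the function $f^{(\nu)}_{\alpha,\lambda}$ is the joint density on $(0,\infty)^2$ of each of the pairs $$\Big(\frac{G_\nu}{\lambda},\frac{\tau_\alpha(\lambda^\alpha)}{\lambda}\Big),\quad \Big(\frac{\tau_\alpha'(G_{\nu/\alpha})}{\lambda},\frac{\tau_\alpha(\lambda^\alpha)}{\lambda}\Big),\quad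 \Big(\frac{\tau_\alpha(G_{\nu/\alpha}+\lambda^\alpha)-\tau_\alpha(\lambda^\alpha)}{\lambda},\frac{\tau_\alpha(\lambda^\alpha)}{\lambda}\Big).$$ (3) The processes $(\tilde S_{\alpha,\nu}(\lambda))_{\lambda>0}$, $\big((\tau_\alpha'(G_{\nu/\alpha})+\tau_\alpha(\lambda^\alpha))/\lambda\big)_{\lambda>0}$ and $\big(G_\nu/\lambda+\tau_\alpha(\lambda^\alpha)/\lambda\big)_{\lambda>0}$ have the same finite-dimensional distributions; in particular the three variables have the same law for each fixed $\lambda$. (4) For every $\lambda>0$, almost surely, $$\tilde S_{\alpha,\nu}(\lambda)=\frac{\tau_\alpha(G_{\nu/\alpha}+\lambda^\alpha)}{\tau_\alpha(\lambda^\alpha)}\times\frac{\tau_\alpha(\lambda^\alpha)}{\lambda}=\frac{\tau_\alpha(G_{\nu/\alpha}+\lambda^\alpha)}{(G_{\nu/\alpha}+\lambda^\alpha)^{1/\alpha}}\times\Big(\frac{G_{\nu/\alpha}+\lambda^\alpha}{\lambda^\alpha}\Big)^{1/\alpha},$$ and in neither of the two products are the factors separated by $\times$ independent. -/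

import Mathlib

open MeasureTheory ProbabilityTheory Set
open scoped NNReal ENNReal

noncomputable section

/-- `μ` is the law of a positive `α`-stable random variable `S_α`, normalised so that its Laplace
transform is `E[exp (-y S_α)] = exp (-y ^ α)`. -/
structure IsPositiveStableLaw (α : ℝ) (μ : Measure ℝ) : Prop where
  isProbabilityMeasure : IsProbabilityMeasure μ
  pos : ∀ᵐ x ∂μ, 0 < x
  laplace : ∀ y : ℝ, 0 ≤ y → ∫ x, Real.exp (-(y * x)) ∂μ = Real.exp (-y ^ α)

/-- `f` is a (version of the) density of `μ` with respect to Lebesgue measure. -/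
structure IsDensityOf (f : ℝ → ℝ) (μ : Measure ℝ) : Prop where
  measurable : Measurable f
  nonneg : ∀ t, 0 ≤ f t
  withDensity_eq : volume.withDensity (fun t => ENNReal.ofReal (f t)) = μ

/-- The Riemann-Liouville fractional integral
`(I^ν_+ f)(t) = (1 / Γ(ν)) ∫_0^t f(u) (t - u)^(ν - 1) du`. -/
def rlIntegral (ν : ℝ) (f : ℝ → ℝ) (t : ℝ) : ℝ :=
  1 / Real.Gamma ν * ∫ u in Ioo 0 t, f u * (t - u) ^ (ν - 1)

/-- `τ` is a subordinator with Laplace exponent `Φ`: a process started at `0` with stationary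
independent increments, with almost surely nondecreasing right-continuous paths, and with
`E[exp (-y (τ t - τ s))] = exp (-(t - s) Φ(y))` for `s ≤ t` and `y ≥ 0`. -/
structure IsSubordinator {Ω : Type*} [MeasurableSpace Ω] (Φ : ℝ → ℝ) (τ : ℝ≥0 → Ω → ℝ)
    (P : Measure Ω) : Prop where
  measurable : ∀ t, Measurable (τ t)
  zero : ∀ᵐ ω ∂P, τ 0 ω = 0
  mono : ∀ᵐ ω ∂P, Monotone (fun t => τ t ω)
  rightCont : ∀ᵐ ω ∂P, ∀ t, ContinuousWithinAt (fun s => τ s ω) (Ici t) t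
  indep : HasIndepIncrements τ P
  laplace : ∀ s t : ℝ≥0, s ≤ t → ∀ y : ℝ, 0 ≤ y →
    ∫ ω, Real.exp (-(y * (τ t ω - τ s ω))) ∂P = Real.exp (-(((t : ℝ) - s) * Φ y))

/-- A generalized gamma subordinator of index `α`: the subordinator with Laplace exponent
`(1 + y)^α - 1`. -/
def IsGenGammaSubordinator {Ω : Type*} [MeasurableSpace Ω] (α : ℝ) (τ : ℝ≥0 → Ω → ℝ)
    (P : Measure Ω) : Prop :=
  IsSubordinator (fun y => (1 + y) ^ α - 1) τ P

/-- The value `τ(x)` at a (possibly random) real time `x ≥ 0`. -/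
def evalAt {Ω : Type*} (τ : ℝ≥0 → Ω → ℝ) (x : Ω → ℝ) (ω : Ω) : ℝ :=
  τ (x ω).toNNReal ω

/-- The density, on `u, s > 0`,
`(l^ν u^(ν-1) exp (-l u) / Γ(ν)) * (exp (l^α) exp (-l s) f(s))`. -/
def pairDensity (α ν l : ℝ) (f : ℝ → ℝ) (u s : ℝ) : ℝ :=
  l ^ ν * u ^ (ν - 1) * Real.exp (-(l * u)) / Real.Gamma ν *
    (Real.exp (l ^ α) * Real.exp (-(l * s)) * f s)

/-- The process `S̃(l) = τ(G + l^α) / l`, `l > 0`. -/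
def tildeS {Ω : Type*} (α : ℝ) (τ : ℝ≥0 → Ω → ℝ) (G : Ω → ℝ) (l : ℝ) (ω : Ω) : ℝ :=
  evalAt τ (fun ω' => G ω' + l ^ α) ω / l

end

/-! ### Laplace transforms on the half line and gamma laws. -/

section

/-! Laws on the half line are identified by their Laplace transforms. Tilting the stable law by `exp
(l ^ α - l s)` gives the transform `exp (l ^ α - (l + y) ^ α)`, which is that of `τ(l ^ α) / l`
(`map_eval_div_eq_tilted`). A generalized gamma subordinator at an independent Gamma(`ν / α`) time
has transform `(1 + y) ^ (-ν)`, so it is Gamma(`ν`) (`map_eval_eq_gammaMeasure`). Hence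
`pairDensity` is the product density of two independent variables. In it the two exponentials
combine to `exp (-l (u + s))`, so the substitution `t = u + s` turns the double integral into the
Laplace integral of `h` times the fractional integral of `f` (`lintegral_rlIntegral_eq`).

The process statements come from conditioning on the random time and using stationary independent
increments at a fixed time (`IsSubordinator.identDistrib_shift`). Splitting `τ` at `G` compares the
processes; splitting it at `l ^ α` gives the pair with the increment.

The first product has ratio `1 + U / V`, with `U` and `V` independent and of finite mean;
independence of `U / V` and `V` would force `E[V²] = (E[V])²`, so `V` would be constant
(`not_indepFun_div`). In the second, the first factor given its random time `x` has a Laplace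
transform at `1` that is injective in `x > 0`, so independence would make the time constant
(`not_indepFun_eval_div_rpow`). -/

theorem hasSum_charFun_map_exp_neg {ρ : Measure ℝ} [IsFiniteMeasure ρ] (hR : ∀ᵐ x ∂ρ, 0 ≤ x)
    (t : ℝ) :
    HasSum (fun n : ℕ => (t * Complex.I) ^ n / (n.factorial : ℂ) *
      ((∫ x, Real.exp (-(n * x)) ∂ρ : ℝ) : ℂ)) (charFun (ρ.map fun x => Real.exp (-x)) t) := by
  rw [charFun_apply_real, integral_map (by fun_prop) (by fun_prop)]
  have h := hasSum_integral_of_dominated_convergence (μ := ρ)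
    (F := fun (n : ℕ) x => (t * Complex.I) ^ n / (n.factorial : ℂ) *
      ((Real.exp (-(n * x)) : ℝ) : ℂ))
    (f := fun x => Complex.exp (t * (Real.exp (-x) : ℝ) * Complex.I))
    (fun n _ => |t| ^ n / n.factorial) (fun n => by fun_prop) ?_ ?_ ?_ ?_
  · convert! h using 2 with n
    rw [integral_const_mul, integral_complex_ofReal]
  · intro n
    filter_upwards [hR] with x hx
    simp only [norm_mul, norm_div, norm_pow, Complex.norm_real, Complex.norm_I, mul_one,
      Complex.norm_natCast, Real.norm_eq_abs, Real.abs_exp]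
    refine mul_le_of_le_one_right (by positivity) (Real.exp_le_one_iff.2 ?_)
    have : 0 ≤ (n : ℝ) * x := by positivity
    linarith
  · exact ae_of_all _ fun x => Real.summable_pow_div_factorial |t|
  · exact integrable_const _
  · refine ae_of_all _ fun x => ?_
    have h := NormedSpace.expSeries_div_hasSum_exp (𝔸 := ℂ)
      (t * (Real.exp (-x) : ℝ) * Complex.I)
    rw [← Complex.exp_eq_exp_ℂ] at h
    convert! h using 2 with n
    have : Real.exp (-(n * x)) = Real.exp (-x) ^ n := by
      rw [← Real.exp_nat_mul]; ring_nf
    rw [this]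
    push_cast
    ring

/-- Uniqueness of the Laplace transform for finite measures on the half line. -/
theorem Measure.ext_of_integral_exp_neg {P Q : Measure ℝ} [IsFiniteMeasure P] [IsFiniteMeasure Q]
    (hP : ∀ᵐ x ∂P, 0 ≤ x) (hQ : ∀ᵐ x ∂Q, 0 ≤ x)
    (h : ∀ y : ℝ, 0 ≤ y → ∫ x, Real.exp (-(y * x)) ∂P = ∫ x, Real.exp (-(y * x)) ∂Q) : P = Q := by
  -- After the change of variable `z = exp (-x)` the laws live on `(0, 1]`, and the Laplace
  -- transform at the integer `n` is the `n`-th moment. These bounded laws are determined by their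
  -- moments, through the power series of the characteristic function.
  have key : P.map (fun x => Real.exp (-x)) = Q.map (fun x => Real.exp (-x)) := by
    refine Measure.ext_of_charFun (funext fun t => ?_)
    refine (hasSum_charFun_map_exp_neg hP t).unique ?_
    simp_rw [h _ (Nat.cast_nonneg _)]
    exact hasSum_charFun_map_exp_neg hQ t
  have h2 := congrArg (Measure.map fun z => -Real.log z) key
  rw [Measure.map_map (by fun_prop) (by fun_prop), Measure.map_map (by fun_prop) (by fun_prop)]
    at h2
  have : ((fun z => -Real.log z) ∘ fun x => Real.exp (-x)) = id := by
    ext x; simp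
  simpa [this] using h2

theorem ae_pos_gammaMeasure (a r : ℝ) : ∀ᵐ x ∂(gammaMeasure a r), 0 < x := by
  have h : ∀ᵐ x ∂(volume : Measure ℝ), x ≠ 0 := by simp [ae_iff]
  rw [gammaMeasure, ae_withDensity_iff (by unfold gammaPDF; fun_prop)]
  filter_upwards [h] with x hx hx'
  by_contra hn
  exact hx' (gammaPDF_of_neg (lt_of_le_of_ne (not_lt.1 hn) hx))

theorem integral_exp_neg_gammaMeasure {a r : ℝ} (ha : 0 < a) (hr : 0 < r) {y : ℝ} (hy : 0 ≤ y) :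
    ∫ x, Real.exp (-(y * x)) ∂(gammaMeasure a r) = (r / (r + y)) ^ a := by
  have hry : 0 < r + y := by positivity
  rw [integral_eq_lintegral_of_nonneg_ae (ae_of_all _ fun x => (Real.exp_pos _).le) (by fun_prop),
    gammaMeasure, lintegral_withDensity_eq_lintegral_mul _ (by unfold gammaPDF; fun_prop)
      (by fun_prop)]
  -- Exponential tilting only changes the rate of a gamma density, from `r` to `r + y`; the
  -- transform is the ratio of normalising constants.
  have : ∀ x, (gammaPDF a r * fun x => ENNReal.ofReal (Real.exp (-(y * x)))) x =
      ENNReal.ofReal ((r / (r + y)) ^ a) * gammaPDF a (r + y) x := by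
    intro x
    rcases lt_or_ge x 0 with hx | hx
    · simp [gammaPDF_of_neg hx]
    · rw [Pi.mul_apply, gammaPDF_of_nonneg hx, gammaPDF_of_nonneg hx,
        ← ENNReal.ofReal_mul (by have := Real.Gamma_pos_of_pos ha; positivity),
        ← ENNReal.ofReal_mul (by positivity), Real.div_rpow hr.le hry.le, mul_assoc, ← Real.exp_add]
      congr 1
      have : -(r * x) + -(y * x) = -((r + y) * x) := by ring
      rw [this]
      have := (Real.rpow_pos_of_pos hry a).ne'
      field_simp
  simp_rw [this]
  rw [lintegral_const_mul _ (by unfold gammaPDF; fun_prop), lintegral_gammaPDF_eq_one ha hry, mul_one,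
    ENNReal.toReal_ofReal (by positivity)]

theorem map_div_gammaMeasure {a l : ℝ} (ha : 0 < a) (hl : 0 < l) :
    (gammaMeasure a 1).map (fun x => x / l) = gammaMeasure a l := by
  have := isProbabilityMeasure_gammaMeasure ha one_pos
  have := isProbabilityMeasure_gammaMeasure ha hl
  refine Measure.ext_of_integral_exp_neg ?_ ?_ fun y hy => ?_
  · rw [ae_map_iff (by fun_prop) measurableSet_Ici]
    filter_upwards [ae_pos_gammaMeasure a 1] with x hx using by positivity
  · filter_upwards [ae_pos_gammaMeasure a l] with x hx using hx.le
  · rw [integral_map (by fun_prop) (by fun_prop), integral_exp_neg_gammaMeasure ha hl hy]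
    have : ∀ x : ℝ, y * (x / l) = y / l * x := fun x => by ring
    simp_rw [this]
    rw [integral_exp_neg_gammaMeasure ha one_pos (by positivity)]
    congr 1
    field_simp

/-- Size-biasing: `x` times the Gamma(`a`) density is `a` times the Gamma(`a + 1`) density, so the
mean is `a`. -/
theorem lintegral_id_gammaMeasure_lt_top {a : ℝ} (ha : 0 < a) :
    ∫⁻ x, ENNReal.ofReal x ∂(gammaMeasure a 1) < ∞ := by
  rw [gammaMeasure, lintegral_withDensity_eq_lintegral_mul _ (by unfold gammaPDF; fun_prop)
      (by fun_prop)]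
  have : ∀ x, (gammaPDF a 1 * fun x => ENNReal.ofReal x) x =
      ENNReal.ofReal a * gammaPDF (a + 1) 1 x := by
    intro x
    rcases lt_or_ge x 0 with hx | hx
    · simp [gammaPDF_of_neg hx]
    · rw [Pi.mul_apply, gammaPDF_of_nonneg hx, gammaPDF_of_nonneg hx,
        ← ENNReal.ofReal_mul (by have := Real.Gamma_pos_of_pos ha; positivity),
        ← ENNReal.ofReal_mul (by positivity), Real.Gamma_add_one ha.ne']
      congr 1
      rcases hx.eq_or_lt with rfl | hx
      · simp [Real.zero_rpow ha.ne']
      · have := (Real.Gamma_pos_of_pos ha).ne'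
        rw [add_sub_cancel_right, Real.rpow_sub_one hx.ne']
        field_simp
        simp
  simp_rw [this]
  rw [lintegral_const_mul _ (by unfold gammaPDF; fun_prop),
    lintegral_gammaPDF_eq_one (by positivity) one_pos, mul_one]
  exact ENNReal.ofReal_lt_top

end

/-! ### Evaluation of paths at random times and the fixed-time Markov property. -/

section

open Filter Topology in
-- These grid points lie strictly to the right of `x`, so a right-continuous path is recovered at
-- `x` from countably many coordinates. This is what makes evaluation at a random time measurable.
theorem tendsto_floor_add_one_div (x : ℝ≥0) :
    Tendsto (fun n : ℕ => ((⌊x * (n + 1)⌋₊ + 1 : ℕ) / (n + 1) : ℝ≥0)) atTop (𝓝[≥] x) := by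
  refine tendsto_nhdsWithin_iff.2 ⟨?_, Eventually.of_forall fun n => ?_⟩
  · have h : Tendsto (fun n : ℕ => x + 1 / ((n : ℝ≥0) + 1)) atTop (𝓝 x) := by
      simpa using tendsto_const_nhds.add (tendsto_one_div_add_atTop_nhds_zero_nat (𝕜 := ℝ≥0))
    refine tendsto_of_tendsto_of_tendsto_of_le_of_le tendsto_const_nhds h (fun n => ?_)
      fun n => ?_
    · simp only
      rw [le_div_iff₀ (by positivity)]
      exact_mod_cast (Nat.lt_floor_add_one (x * (n + 1))).le
    · simp only
      rw [div_le_iff₀ (by positivity), add_mul, one_div, inv_mul_cancel₀ (by positivity)]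
      push_cast
      gcongr
      exact Nat.floor_le zero_le
  · simp only [mem_Ici]
    rw [le_div_iff₀ (by positivity)]
    exact_mod_cast (Nat.lt_floor_add_one (x * (n + 1))).le

/-- A jointly measurable version of the evaluation `p x` of a right-continuous path `p`. -/
noncomputable def pathEval (x : ℝ≥0) (p : ℝ≥0 → ℝ) : ℝ :=
  Filter.limsup (fun n : ℕ => p ((⌊x * (n + 1)⌋₊ + 1 : ℕ) / (n + 1))) Filter.atTop

theorem pathEval_eq {x : ℝ≥0} {p : ℝ≥0 → ℝ} (h : ContinuousWithinAt p (Ici x) x) :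
    pathEval x p = p x :=
  (Filter.Tendsto.comp h (tendsto_floor_add_one_div x)).limsup_eq

theorem measurable_pathEval : Measurable (Function.uncurry pathEval) := by
  refine Measurable.limsup fun n => ?_
  -- The `n`-th term depends on the time only through an integer, so joint measurability reduces to
  -- a countable first coordinate.
  have h : Measurable fun q : ℕ × (ℝ≥0 → ℝ) => q.2 ((q.1 + 1 : ℕ) / (n + 1)) :=
    measurable_from_prod_countable_right fun k => by
      simpa using measurable_pi_apply _
  exact h.comp (f := fun q : ℝ≥0 × (ℝ≥0 → ℝ) => (⌊q.1 * (n + 1)⌋₊, q.2)) (by fun_prop)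

variable {Ω E S β : Type*} [MeasurableSpace Ω] [MeasurableSpace E] [MeasurableSpace S]
  [MeasurableSpace β]

theorem lintegral_comp_of_indepFun {P : Measure Ω} [IsFiniteMeasure P] {X : Ω → E} {Y : Ω → S}
    (hX : AEMeasurable X P) (hY : AEMeasurable Y P) (h : IndepFun X Y P) {F : E → S → ℝ≥0∞}
    (hF : Measurable (Function.uncurry F)) :
    ∫⁻ ω, F (X ω) (Y ω) ∂P = ∫⁻ x, ∫⁻ ω, F x (Y ω) ∂P ∂(P.map X) := by
  have h1 := lintegral_map' (μ := P) (f := Function.uncurry F) hF.aemeasurable (hX.prodMk hY)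
  rw [h.map_prod_eq_prod_map_map hX hY, lintegral_prod _ hF.aemeasurable] at h1
  refine h1.symm.trans (lintegral_congr fun x => ?_)
  exact lintegral_map' (hF.comp measurable_prodMk_left).aemeasurable hY

/-- If `A x Y` and `B x Y` have the same law for every `x` and `X` is independent of `Y`, then
`A X Y` and `B X Y` have the same law. -/
theorem map_eq_map_of_indepFun {P : Measure Ω} [IsFiniteMeasure P] {X : Ω → E} {Y : Ω → S}
    (hX : AEMeasurable X P) (hY : AEMeasurable Y P) (h : IndepFun X Y P) {A B : E → S → β}
    (hA : Measurable (Function.uncurry A)) (hB : Measurable (Function.uncurry B))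
    (hAB : ∀ x, P.map (fun ω => A x (Y ω)) = P.map (fun ω => B x (Y ω))) :
    P.map (fun ω => A (X ω) (Y ω)) = P.map (fun ω => B (X ω) (Y ω)) := by
  refine Measure.ext_of_lintegral _ fun F hF => ?_
  have hA' : AEMeasurable (fun ω => A (X ω) (Y ω)) P := hA.comp_aemeasurable (hX.prodMk hY)
  have hB' : AEMeasurable (fun ω => B (X ω) (Y ω)) P := hB.comp_aemeasurable (hX.prodMk hY)
  rw [lintegral_map' hF.aemeasurable hA', lintegral_map' hF.aemeasurable hB',
    lintegral_comp_of_indepFun hX hY h (F := fun x y => F (A x y)) (hF.comp hA),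
    lintegral_comp_of_indepFun hX hY h (F := fun x y => F (B x y)) (hF.comp hB)]
  refine lintegral_congr fun x => ?_
  have hAx : AEMeasurable (fun ω => A x (Y ω)) P :=
    (hA.comp measurable_prodMk_left).comp_aemeasurable hY
  have hBx : AEMeasurable (fun ω => B x (Y ω)) P :=
    (hB.comp measurable_prodMk_left).comp_aemeasurable hY
  rw [← lintegral_map' hF.aemeasurable hAx, ← lintegral_map' hF.aemeasurable hBx, hAB]

namespace IsSubordinator

variable {P : Measure Ω} {Φ : ℝ → ℝ} {τ σ σ' : ℝ≥0 → Ω → ℝ}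

theorem measurable_path (hτ : IsSubordinator Φ τ P) : Measurable fun ω (t : ℝ≥0) => τ t ω :=
  measurable_pi_lambda _ hτ.measurable

theorem ae_pathEval (hτ : IsSubordinator Φ τ P) :
    ∀ᵐ ω ∂P, ∀ x, pathEval x (fun t => τ t ω) = τ x ω := by
  filter_upwards [hτ.rightCont] with ω hω x using pathEval_eq (hω x)

theorem aemeasurable_eval (hτ : IsSubordinator Φ τ P) {X : Ω → ℝ≥0} (hX : AEMeasurable X P) :
    AEMeasurable (fun ω => τ (X ω) ω) P := by
  refine (measurable_pathEval.comp_aemeasurable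
    (hX.prodMk hτ.measurable_path.aemeasurable)).congr ?_
  filter_upwards [hτ.ae_pathEval] with ω hω using hω _

theorem ae_nonneg (hτ : IsSubordinator Φ τ P) : ∀ᵐ ω ∂P, ∀ t, 0 ≤ τ t ω := by
  filter_upwards [hτ.zero, hτ.mono] with ω h0 hm t
  rw [← h0]
  exact hm zero_le

/-- An increment is nonnegative and its Laplace transform involves only the elapsed time. Allowing a
second process `σ` lets the lemma compare independent copies as well as increments of one process.
-/
theorem map_sub_eq [IsProbabilityMeasure P] (hτ : IsSubordinator Φ τ P)
    (hσ : IsSubordinator Φ σ P) {s t s' t' : ℝ≥0} (hst : s ≤ t) (hst' : s' ≤ t')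
    (h : (t : ℝ) - s = t' - s') :
    P.map (τ t - τ s) = P.map (σ t' - σ s') := by
  have := hτ.measurable
  have := hσ.measurable
  refine Measure.ext_of_integral_exp_neg ?_ ?_ fun y hy => ?_
  · rw [ae_map_iff (by fun_prop) measurableSet_Ici]
    filter_upwards [hτ.mono] with ω hω using sub_nonneg.2 (hω hst)
  · rw [ae_map_iff (by fun_prop) measurableSet_Ici]
    filter_upwards [hσ.mono] with ω hω using sub_nonneg.2 (hω hst')
  · rw [integral_map (by fun_prop) (by fun_prop), integral_map (by fun_prop) (by fun_prop)]
    exact ((hτ.laplace s t hst y hy).trans (by rw [h])).trans (hσ.laplace s' t' hst' y hy).symm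

theorem map_eq [IsProbabilityMeasure P] (hτ : IsSubordinator Φ τ P) (hσ : IsSubordinator Φ σ P)
    (t : ℝ≥0) : P.map (τ t) = P.map (σ t) := by
  have h := hτ.map_sub_eq hσ (zero_le (a := t)) (zero_le (a := t)) rfl
  rwa [Measure.map_congr (g := τ t), Measure.map_congr (f := σ t - σ 0) (g := σ t)] at h
  · filter_upwards [hσ.zero] with ω hω using by simp [hω]
  · filter_upwards [hτ.zero] with ω hω using by simp [hω]

theorem integral_exp_neg (hτ : IsSubordinator Φ τ P) (t : ℝ≥0) {y : ℝ} (hy : 0 ≤ y) :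
    ∫ ω, Real.exp (-(y * τ t ω)) ∂P = Real.exp (-(t * Φ y)) := by
  have h := hτ.laplace 0 t zero_le y hy
  simp only [NNReal.coe_zero, sub_zero] at h
  rw [← h]
  refine integral_congr_ae ?_
  filter_upwards [hτ.zero] with ω hω using by simp [hω]

theorem indepFun_shift_of_monotone (hτ : IsSubordinator Φ τ P) (g : ℝ≥0) {s : ℕ → ℝ≥0}
    (hs : Monotone s) (n : ℕ) :
    IndepFun (τ g) (fun ω (k : Fin n) => τ (g + s k) ω - τ g ω) P := by
  -- Along `0, g, g + s 0, g + s 1, …` the increment number `0` is `τ g` almost surely, and the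
  -- increments numbered `1, …, k + 1` telescope to `τ (g + s k) - τ g`. Independence of disjoint
  -- blocks of increments then suffices.
  let T : ℕ → ℝ≥0
    | 0 => 0
    | 1 => g
    | k + 2 => g + s k
  have hT : Monotone T := by
    refine monotone_nat_of_le_succ fun k => ?_
    match k with
    | 0 => exact zero_le
    | 1 => exact le_self_add
    | k + 2 => exact add_le_add_right (hs (Nat.le_succ k)) g
  have hm := hτ.measurable
  have h := (hτ.indep.nat hT).indepFun_finset {0} ((Finset.range n).image Nat.succ)
    (by simp) fun i => by fun_prop
  have hφ : Measurable fun v : ({0} : Finset ℕ) → ℝ => v ⟨0, Finset.mem_singleton_self 0⟩ :=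
    measurable_pi_apply _
  have hψ : Measurable fun (v : (Finset.range n).image Nat.succ → ℝ) (k : Fin n) =>
      ∑ j ∈ (Finset.range (k + 1)).attach, v ⟨j.1 + 1, Finset.mem_image.2 ⟨j.1, by
        have := Finset.mem_range.1 j.2
        simp only [Finset.mem_range]; omega, rfl⟩⟩ := by fun_prop
  have h2 := h.comp hφ hψ
  refine h2.congr ?_ (ae_of_all _ fun ω => ?_)
  · filter_upwards [hτ.zero] with ω hω
    simp [T, hω]
  · ext k
    simp only [Function.comp]
    rw [Finset.sum_attach (Finset.range (k + 1))
      (fun j => τ (T (j + 1 + 1)) ω - τ (T (j + 1)) ω),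
      Finset.sum_range_sub (fun j => τ (T (j + 1)) ω)]

theorem map_shift_of_monotone [IsProbabilityMeasure P] (hτ : IsSubordinator Φ τ P)
    (hσ : IsSubordinator Φ σ P) (g : ℝ≥0) {s : ℕ → ℝ≥0} (hs : Monotone s) (n : ℕ) :
    P.map (fun ω (k : Fin n) => τ (g + s k) ω - τ g ω) =
      P.map (fun ω (k : Fin n) => σ (s k) ω) := by
  let T : ℕ → ℝ≥0
    | 0 => 0
    | k + 1 => s k
  have hT : Monotone T := by
    refine monotone_nat_of_le_succ fun k => ?_
    match k with
    | 0 => exact zero_le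
    | k + 1 => exact hs (Nat.le_succ k)
  have hm := hτ.measurable
  have hm' := hσ.measurable
  -- Both increment vectors have product laws with equal marginals; applying the partial-sum map to
  -- both restores the values of the processes.
  have h1 := ((hτ.indep.nat (t := fun k => g + T k)
    fun a b hab => add_le_add_right (hT hab) g).precomp
    (Fin.val_injective (n := n))).map_fun_eq_pi_map (fun i => by fun_prop)
  have h2 := ((hσ.indep.nat hT).precomp
    (Fin.val_injective (n := n))).map_fun_eq_pi_map (fun i => by fun_prop)
  have h3 := h1.trans ((congrArg Measure.pi (funext fun i : Fin n => hτ.map_sub_eq hσ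
    (add_le_add_right (hT (Nat.le_succ i)) g) (hT (Nat.le_succ i))
      (by push_cast; ring))).trans h2.symm)
  have h4 := congrArg (Measure.map (fun (v : Fin n → ℝ) (k : Fin n) => ∑ j ∈ (Finset.range (k + 1)).attach,
      v (⟨j.1, by have := Finset.mem_range.1 j.2; omega⟩ : Fin n))) h3
  rw [Measure.map_map (by fun_prop) (by fun_prop), Measure.map_map (by fun_prop) (by fun_prop)]
    at h4
  convert! h4 using 1
  · congr 1
    ext ω k
    simp only [Function.comp]
    rw [Finset.sum_attach (Finset.range (k + 1))
      (fun j => τ (g + T (j + 1)) ω - τ (g + T j) ω),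
      Finset.sum_range_sub (fun j => τ (g + T j) ω)]
    simp [T]
  · refine Measure.map_congr ?_
    filter_upwards [hσ.zero] with ω hω
    ext k
    simp only [Function.comp]
    rw [Finset.sum_attach (Finset.range (k + 1))
      (fun j => σ (T (j + 1)) ω - σ (T j) ω),
      Finset.sum_range_sub (fun j => σ (T j) ω)]
    simp [T, hω]

end IsSubordinator

/-- Reduces arbitrary finite families of times to monotone sequences: `r` is the running maximum of
the sorted family, constant past its end, and `e` undoes the sorting. -/
theorem exists_monotone_nat_perm {n : ℕ} (s : Fin n → ℝ≥0) :
    ∃ (r : ℕ → ℝ≥0) (e : Fin n → Fin n), Monotone r ∧ ∀ i, s i = r (e i) := by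
  have hm := Tuple.monotone_sort s
  refine ⟨fun k => (Finset.univ.filter fun i : Fin n => (i : ℕ) ≤ k).sup (s ∘ Tuple.sort s),
    (Tuple.sort s).symm, fun a b hab => Finset.sup_mono fun i hi => ?_, fun i => ?_⟩
  · simp only [Finset.mem_filter, Finset.mem_univ, true_and] at hi ⊢
    omega
  · refine le_antisymm ?_ (Finset.sup_le fun j hj => ?_)
    · have h := Finset.le_sup (s := Finset.univ.filter fun j : Fin n => (j : ℕ) ≤
        (Tuple.sort s).symm i) (f := s ∘ Tuple.sort s) (b := (Tuple.sort s).symm i)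
        (Finset.mem_filter.2 ⟨Finset.mem_univ _, le_rfl⟩)
      rwa [Function.comp_apply, Equiv.apply_symm_apply] at h
    · have := hm (a := j) (b := (Tuple.sort s).symm i) (by simpa using hj)
      rwa [Function.comp_apply (x := (Tuple.sort s).symm i), Equiv.apply_symm_apply] at this

namespace IsSubordinator

variable {P : Measure Ω} [IsProbabilityMeasure P] {Φ : ℝ → ℝ} {τ σ σ' : ℝ≥0 → Ω → ℝ}

/-- The Markov property at a fixed time: the shifted process is an independent copy. -/
theorem identDistrib_shift (hτ : IsSubordinator Φ τ P) (hσ : IsSubordinator Φ σ P)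
    (hσ' : IsSubordinator Φ σ' P)
    (hi : IndepFun (fun ω (t : ℝ≥0) => σ t ω) (fun ω (t : ℝ≥0) => σ' t ω) P)
    (g : ℝ≥0) {n : ℕ} (s : Fin n → ℝ≥0) :
    IdentDistrib (fun ω => (τ g ω, fun i => τ (g + s i) ω - τ g ω))
      (fun ω => (σ g ω, fun i => σ' (s i) ω)) P P := by
  obtain ⟨r, e, hr, hs⟩ := exists_monotone_nat_perm s
  have hm := hτ.measurable
  have hm' := hσ.measurable
  have hm'' := hσ'.measurable
  have he : Measurable fun (v : Fin n → ℝ) i => v (e i) := by fun_prop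
  refine IdentDistrib.prodMk ⟨by fun_prop, by fun_prop, hτ.map_eq hσ g⟩
    ⟨by fun_prop, by fun_prop, ?_⟩ ?_ ?_
  · have h := congrArg (Measure.map fun (v : Fin n → ℝ) i => v (e i))
      (hτ.map_shift_of_monotone hσ' g hr n)
    rw [Measure.map_map he (by fun_prop), Measure.map_map he (by fun_prop)] at h
    simpa only [Function.comp_def, ← hs] using h
  · have h := (hτ.indepFun_shift_of_monotone g hr n).comp measurable_id he
    simpa only [Function.comp_def, id, ← hs] using h
  · exact hi.comp (φ := fun p : ℝ≥0 → ℝ => p g)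
      (ψ := fun (p : ℝ≥0 → ℝ) i => p (s i)) (by fun_prop) (by fun_prop)

end IsSubordinator

end

/-! ### Independent random times, and the laws of the two coordinates. -/

section

variable {Ω E S S' : Type*} [MeasurableSpace Ω] [MeasurableSpace E] [MeasurableSpace S]
  [MeasurableSpace S'] {P : Measure Ω} [IsProbabilityMeasure P]

/-- Regrouping of mutual independence, by associativity of product measures. With `A`, `B` the paths
of `τ`, `τ'` and `X` the random time, it makes `τ'(X)` independent of `τ`. -/
theorem indepFun_prodMk_of_indepFun {X : Ω → E} {A : Ω → S} {B : Ω → S'} (hX : AEMeasurable X P)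
    (hA : AEMeasurable A P) (hB : AEMeasurable B P) (hAB : IndepFun A B P)
    (h : IndepFun X (fun ω => (A ω, B ω)) P) : IndepFun (fun ω => (X ω, B ω)) A P := by
  have h1 : IndepFun X (fun ω => (B ω, A ω)) P := h.comp measurable_id measurable_swap
  have h2 : IndepFun X B P := h1.comp measurable_id measurable_fst
  have : IsProbabilityMeasure (P.map A) := Measure.isProbabilityMeasure_map hA
  have : IsProbabilityMeasure (P.map B) := Measure.isProbabilityMeasure_map hB
  have : IsProbabilityMeasure (P.map X) := Measure.isProbabilityMeasure_map hX
  rw [indepFun_iff_map_prod_eq_prod_map_map (hX.prodMk hB) hA,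
    h2.map_prod_eq_prod_map_map hX hB]
  have h3 := (measurePreserving_prodAssoc (P.map X) (P.map B) (P.map A)).symm.map_eq
  rw [← hAB.symm.map_prod_eq_prod_map_map hB hA,
    ← h1.map_prod_eq_prod_map_map hX (hB.prodMk hA),
    AEMeasurable.map_map_of_aemeasurable (MeasurableEquiv.measurable _).aemeasurable
      (hX.prodMk (hB.prodMk hA))] at h3
  exact h3

namespace IsSubordinator

variable {Φ : ℝ → ℝ} {τ τ' : ℝ≥0 → Ω → ℝ} {X : Ω → ℝ≥0}

theorem identDistrib_eval_add (hτ : IsSubordinator Φ τ P) (hτ' : IsSubordinator Φ τ' P)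
    (hi : IndepFun (fun ω (t : ℝ≥0) => τ t ω) (fun ω (t : ℝ≥0) => τ' t ω) P)
    (hX : AEMeasurable X P)
    (hXi : IndepFun X (fun ω => ((fun t : ℝ≥0 => τ t ω), (fun t : ℝ≥0 => τ' t ω))) P)
    {n : ℕ} (s : Fin n → ℝ≥0) :
    IdentDistrib (fun ω i => τ (X ω + s i) ω) (fun ω i => τ' (X ω) ω + τ (s i) ω) P P := by
  have hm := hτ.measurable
  have hX' := hτ'.aemeasurable_eval hX
  refine ⟨aemeasurable_pi_lambda _ fun i => hτ.aemeasurable_eval (by fun_prop),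
    aemeasurable_pi_lambda _ fun i => hX'.add (hm (s i)).aemeasurable, ?_⟩
  have hpe := measurable_pathEval
  have hA : Measurable (Function.uncurry fun (x : ℝ≥0) (p : (ℝ≥0 → ℝ) × (ℝ≥0 → ℝ)) =>
      fun i => pathEval (x + s i) p.1) := measurable_pi_lambda _ fun i =>
    hpe.comp (f := fun q : ℝ≥0 × ((ℝ≥0 → ℝ) × (ℝ≥0 → ℝ)) => (q.1 + s i, q.2.1)) (by fun_prop)
  have hB : Measurable (Function.uncurry fun (x : ℝ≥0) (p : (ℝ≥0 → ℝ) × (ℝ≥0 → ℝ)) =>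
      fun i => pathEval x p.2 + p.1 (s i)) := measurable_pi_lambda _ fun i =>
    (hpe.comp (f := fun q : ℝ≥0 × ((ℝ≥0 → ℝ) × (ℝ≥0 → ℝ)) => (q.1, q.2.2))
      (by fun_prop)).add
      (by fun_prop : Measurable fun q : ℝ≥0 × ((ℝ≥0 → ℝ) × (ℝ≥0 → ℝ)) => q.2.1 (s i))
  have h := map_eq_map_of_indepFun hX
    (hτ.measurable_path.prodMk hτ'.measurable_path).aemeasurable hXi hA hB fun x => ?_
  · rw [Measure.map_congr (g := fun ω i => τ (X ω + s i) ω),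
      Measure.map_congr (f := fun ω i => pathEval (X ω) (fun t : ℝ≥0 => τ' t ω) + τ (s i) ω)
        (g := fun ω i => τ' (X ω) ω + τ (s i) ω)] at h
    · exact h
    · filter_upwards [hτ'.ae_pathEval] with ω hω using by simp [hω]
    · filter_upwards [hτ.ae_pathEval] with ω hω using by simp [hω]
  · have h2 := ((hτ.identDistrib_shift hτ' hτ hi.symm x s).comp
      (u := fun v i => v.1 + v.2 i) (by fun_prop)).map_eq
    rw [Measure.map_congr (g := fun ω i => τ (x + s i) ω),
      Measure.map_congr (f := fun ω i => pathEval x (fun t : ℝ≥0 => τ' t ω) + τ (s i) ω)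
        (g := fun ω i => τ' x ω + τ (s i) ω)]
    · simpa [Function.comp_def] using h2
    · filter_upwards [hτ'.ae_pathEval] with ω hω using by simp [hω]
    · filter_upwards [hτ.ae_pathEval] with ω hω using by simp [hω]

theorem identDistrib_increment (hτ : IsSubordinator Φ τ P) (hτ' : IsSubordinator Φ τ' P)
    (hi : IndepFun (fun ω (t : ℝ≥0) => τ t ω) (fun ω (t : ℝ≥0) => τ' t ω) P)
    (hX : AEMeasurable X P)
    (hXi : IndepFun X (fun ω => ((fun t : ℝ≥0 => τ t ω), (fun t : ℝ≥0 => τ' t ω))) P)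
    (c : ℝ≥0) :
    IdentDistrib (fun ω => (τ (X ω + c) ω - τ c ω, τ c ω)) (fun ω => (τ' (X ω) ω, τ c ω)) P P := by
  have hm := hτ.measurable
  have hX' := hτ'.aemeasurable_eval hX
  have hX'' := hτ.aemeasurable_eval (X := fun ω => X ω + c) (by fun_prop)
  refine ⟨(hX''.sub (hm c).aemeasurable).prodMk (hm c).aemeasurable,
    hX'.prodMk (hm c).aemeasurable, ?_⟩
  have hpe := measurable_pathEval
  have hc : Measurable fun q : ℝ≥0 × ((ℝ≥0 → ℝ) × (ℝ≥0 → ℝ)) => q.2.1 c := by fun_prop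
  have hA : Measurable (Function.uncurry fun (x : ℝ≥0) (p : (ℝ≥0 → ℝ) × (ℝ≥0 → ℝ)) =>
      (pathEval (x + c) p.1 - p.1 c, p.1 c)) :=
    ((hpe.comp (f := fun q : ℝ≥0 × ((ℝ≥0 → ℝ) × (ℝ≥0 → ℝ)) => (q.1 + c, q.2.1))
      (by fun_prop)).sub hc).prodMk hc
  have hB : Measurable (Function.uncurry fun (x : ℝ≥0) (p : (ℝ≥0 → ℝ) × (ℝ≥0 → ℝ)) =>
      (pathEval x p.2, p.1 c)) :=
    (hpe.comp (f := fun q : ℝ≥0 × ((ℝ≥0 → ℝ) × (ℝ≥0 → ℝ)) => (q.1, q.2.2))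
      (by fun_prop)).prodMk hc
  have h := map_eq_map_of_indepFun hX
    (hτ.measurable_path.prodMk hτ'.measurable_path).aemeasurable hXi hA hB fun x => ?_
  · rw [Measure.map_congr (g := fun ω => (τ (X ω + c) ω - τ c ω, τ c ω)),
      Measure.map_congr (f := fun ω => (pathEval (X ω) (fun t : ℝ≥0 => τ' t ω), τ c ω))
        (g := fun ω => (τ' (X ω) ω, τ c ω))] at h
    · exact h
    · filter_upwards [hτ'.ae_pathEval] with ω hω using by simp [hω]
    · filter_upwards [hτ.ae_pathEval] with ω hω using by simp [hω]
  · have h2 := ((hτ.identDistrib_shift hτ hτ' hi c fun _ : Fin 1 => x).comp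
      (u := fun v => (v.2 0, v.1)) (by fun_prop)).map_eq
    rw [Measure.map_congr (g := fun ω => (τ (c + x) ω - τ c ω, τ c ω)),
      Measure.map_congr (f := fun ω => (pathEval x (fun t : ℝ≥0 => τ' t ω), τ c ω))
        (g := fun ω => (τ' x ω, τ c ω))]
    · simpa [Function.comp_def] using h2
    · filter_upwards [hτ'.ae_pathEval] with ω hω using by simp [hω]
    · filter_upwards [hτ.ae_pathEval] with ω hω using by simp [hω, add_comm]

theorem lintegral_comp_eval (hτ : IsSubordinator Φ τ P) (hX : AEMeasurable X P)
    (hXi : IndepFun X (fun ω (t : ℝ≥0) => τ t ω) P) {F : ℝ≥0 → ℝ → ℝ≥0∞}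
    (hF : Measurable (Function.uncurry F)) :
    ∫⁻ ω, F (X ω) (τ (X ω) ω) ∂P = ∫⁻ x, ∫⁻ ω, F x (τ x ω) ∂P ∂(P.map X) := by
  have h := lintegral_comp_of_indepFun hX hτ.measurable_path.aemeasurable hXi
    (F := fun x p => F x (pathEval x p)) (hF.comp (measurable_fst.prodMk measurable_pathEval))
  convert! h using 1
  · refine lintegral_congr_ae ?_
    filter_upwards [hτ.ae_pathEval] with ω hω using by rw [hω]
  · refine lintegral_congr fun x => lintegral_congr_ae ?_
    filter_upwards [hτ.ae_pathEval] with ω hω using by rw [hω]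

theorem lintegral_exp_neg (hτ : IsSubordinator Φ τ P) (t : ℝ≥0) {y : ℝ} (hy : 0 ≤ y) :
    ∫⁻ ω, ENNReal.ofReal (Real.exp (-(y * τ t ω))) ∂P =
      ENNReal.ofReal (Real.exp (-(t * Φ y))) := by
  have hm := hτ.measurable
  rw [← hτ.integral_exp_neg t hy, ofReal_integral_eq_lintegral_ofReal _
    (ae_of_all _ fun _ => (Real.exp_pos _).le)]
  refine Integrable.of_bound (by fun_prop) 1 ?_
  filter_upwards [hτ.ae_nonneg] with ω hω
  have := mul_nonneg hy (hω t)
  simpa [Real.abs_exp] using this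

end IsSubordinator

/-- Given `G`, the transform is `exp (-G ((1 + y) ^ α - 1))`. Averaging over `G` gives `(1 + ((1 +
y) ^ α - 1)) ^ (-ν / α) = (1 + y) ^ (-ν)`. -/
theorem map_eval_eq_gammaMeasure {α ν : ℝ} (hα0 : 0 < α) (hν : 0 < ν)
    {τ : ℝ≥0 → Ω → ℝ} (hτ : IsGenGammaSubordinator α τ P) {G : Ω → ℝ}
    (hG : HasLaw G (gammaMeasure (ν / α) 1) P)
    (hGτ : IndepFun G (fun ω (t : ℝ≥0) => τ t ω) P) :
    P.map (evalAt τ G) = gammaMeasure ν 1 := by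
  have := isProbabilityMeasure_gammaMeasure hν one_pos
  have hGm := hG.aemeasurable
  have hX : AEMeasurable (fun ω => (G ω).toNNReal) P := by fun_prop
  have hXi : IndepFun (fun ω => (G ω).toNNReal) (fun ω (t : ℝ≥0) => τ t ω) P :=
    hGτ.comp measurable_real_toNNReal measurable_id
  have he : AEMeasurable (evalAt τ G) P := IsSubordinator.aemeasurable_eval hτ hX
  refine Measure.ext_of_integral_exp_neg ?_ ?_ fun y hy => ?_
  · rw [ae_map_iff he measurableSet_Ici]
    filter_upwards [IsSubordinator.ae_nonneg hτ] with ω hω using hω _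
  · filter_upwards [ae_pos_gammaMeasure ν 1] with x hx using hx.le
  have hΦ : 0 ≤ (1 + y) ^ α - 1 := sub_nonneg.2 (Real.one_le_rpow (by linarith) hα0.le)
  rw [integral_map he (by fun_prop), integral_exp_neg_gammaMeasure hν one_pos hy,
    integral_eq_lintegral_of_nonneg_ae (ae_of_all _ fun _ => (Real.exp_pos _).le) (by fun_prop)]
  have h1 := IsSubordinator.lintegral_comp_eval hτ hX hXi
    (F := fun _ z => ENNReal.ofReal (Real.exp (-(y * z)))) (by unfold Function.uncurry; fun_prop)
  change (∫⁻ ω, ENNReal.ofReal (Real.exp (-(y * τ (G ω).toNNReal ω))) ∂P).toReal = _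
  simp_rw [h1, IsSubordinator.lintegral_exp_neg hτ _ hy]
  rw [lintegral_map' (by fun_prop) hX]
  have h2 : ∀ᵐ ω ∂P, 0 < G ω :=
    (hG.ae_iff (p := fun x => 0 < x) (measurableSet_setOfPred.1 measurableSet_Ioi)).2
      (ae_pos_gammaMeasure _ _)
  have h3 : ∫⁻ ω, ENNReal.ofReal (Real.exp (-((G ω).toNNReal * ((1 + y) ^ α - 1)))) ∂P =
      ∫⁻ x, ENNReal.ofReal (Real.exp (-(((1 + y) ^ α - 1) * x))) ∂(gammaMeasure (ν / α) 1) := by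
    rw [← hG.map_eq, lintegral_map' (by fun_prop) hGm]
    refine lintegral_congr_ae ?_
    filter_upwards [h2] with ω hω
    rw [Real.coe_toNNReal _ hω.le, mul_comm]
  rw [h3, ← integral_eq_lintegral_of_nonneg_ae (ae_of_all _ fun _ => (Real.exp_pos _).le)
    (by fun_prop), integral_exp_neg_gammaMeasure (by positivity) one_pos hΦ, add_sub_cancel,
    Real.div_rpow zero_le_one (by positivity), Real.div_rpow zero_le_one (by positivity),
    ← Real.rpow_mul (by positivity), mul_div_cancel₀ _ hα0.ne']
  simp

section Density

variable {α : ℝ} {μ : Measure ℝ} {f : ℝ → ℝ}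

theorem withDensity_eq_restrict_Ioi {g : ℝ → ℝ≥0∞}
    (h : ∀ᵐ x ∂((volume : Measure ℝ).withDensity g), 0 < x) :
    (volume : Measure ℝ).withDensity g = (volume.restrict (Ioi 0)).withDensity g := by
  rw [← restrict_withDensity measurableSet_Ioi, Measure.restrict_eq_self_of_ae_mem (s := Ioi 0) h]

theorem tilted_eq_withDensity (hf : IsDensityOf f μ) (l : ℝ) :
    volume.withDensity (fun s => ENNReal.ofReal (Real.exp (l ^ α) * Real.exp (-(l * s)) * f s)) =
      μ.withDensity (fun s => ENNReal.ofReal (Real.exp (l ^ α) * Real.exp (-(l * s)))) := by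
  have hfm := hf.measurable
  rw [← hf.withDensity_eq, ← withDensity_mul _ (by fun_prop) (by fun_prop)]
  congr 1
  ext s
  rw [Pi.mul_apply, ← ENNReal.ofReal_mul (hf.nonneg s), mul_comm]

theorem lintegral_tilted (hμ : IsPositiveStableLaw α μ) {l y : ℝ} (hl : 0 ≤ l) (hy : 0 ≤ y) :
    ∫⁻ s, ENNReal.ofReal (Real.exp (-(y * s)))
      ∂(μ.withDensity fun s => ENNReal.ofReal (Real.exp (l ^ α) * Real.exp (-(l * s)))) =
      ENNReal.ofReal (Real.exp (l ^ α - (l + y) ^ α)) := by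
  have := hμ.isProbabilityMeasure
  rw [lintegral_withDensity_eq_lintegral_mul _ (by fun_prop) (by fun_prop)]
  have : ∀ s, ((fun s => ENNReal.ofReal (Real.exp (l ^ α) * Real.exp (-(l * s)))) *
      fun s => ENNReal.ofReal (Real.exp (-(y * s)))) s =
      ENNReal.ofReal (Real.exp (l ^ α)) * ENNReal.ofReal (Real.exp (-((l + y) * s))) := by
    intro s
    rw [Pi.mul_apply, ← ENNReal.ofReal_mul (by positivity), ← ENNReal.ofReal_mul (by positivity),
      mul_assoc, ← Real.exp_add]
    ring_nf
  simp_rw [this]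
  rw [lintegral_const_mul _ (by fun_prop), ← ofReal_integral_eq_lintegral_ofReal ?_
    (ae_of_all _ fun _ => (Real.exp_pos _).le), hμ.laplace _ (by positivity),
    ← ENNReal.ofReal_mul (by positivity), ← Real.exp_add, sub_eq_add_neg]
  refine Integrable.of_bound (by fun_prop) 1 ?_
  filter_upwards [hμ.pos] with s hs
  have : 0 ≤ (l + y) * s := by positivity
  simpa [Real.abs_exp] using this

theorem isProbabilityMeasure_tilted (hμ : IsPositiveStableLaw α μ) {l : ℝ} (hl : 0 ≤ l) :
    IsProbabilityMeasure
      (μ.withDensity fun s => ENNReal.ofReal (Real.exp (l ^ α) * Real.exp (-(l * s)))) := by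
  have h := lintegral_tilted hμ hl le_rfl
  exact ⟨by simpa using h⟩

theorem ae_pos_tilted (hμ : IsPositiveStableLaw α μ) (l : ℝ) :
    ∀ᵐ s ∂(μ.withDensity fun s => ENNReal.ofReal (Real.exp (l ^ α) * Real.exp (-(l * s)))),
      0 < s :=
  (withDensity_absolutelyContinuous _ _).ae_le hμ.pos

/-- The two transforms agree because `l ^ α * ((1 + y / l) ^ α - 1) = (l + y) ^ α - l ^ α`. -/
theorem map_eval_div_eq_tilted (hμ : IsPositiveStableLaw α μ) {τ : ℝ≥0 → Ω → ℝ}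
    (hτ : IsGenGammaSubordinator α τ P) {l : ℝ} (hl : 0 < l) :
    P.map (fun ω => τ (l ^ α).toNNReal ω / l) =
      μ.withDensity (fun s => ENNReal.ofReal (Real.exp (l ^ α) * Real.exp (-(l * s)))) := by
  have := isProbabilityMeasure_tilted hμ hl.le
  have hm := hτ.measurable
  refine Measure.ext_of_integral_exp_neg ?_ ?_ fun y hy => ?_
  · rw [ae_map_iff (by fun_prop) measurableSet_Ici]
    filter_upwards [IsSubordinator.ae_nonneg hτ] with ω hω using div_nonneg (hω _) hl.le
  · filter_upwards [ae_pos_tilted hμ l] with x hx using hx.le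
  · rw [integral_map (by fun_prop) (by fun_prop),
      integral_eq_lintegral_of_nonneg_ae (ae_of_all _ fun _ => (Real.exp_pos _).le)
        (by fun_prop) (μ := μ.withDensity _), lintegral_tilted hμ hl.le hy,
      ENNReal.toReal_ofReal (Real.exp_pos _).le]
    have h1 : ∀ ω, y * (τ (l ^ α).toNNReal ω / l) = y / l * τ (l ^ α).toNNReal ω :=
      fun ω => by ring
    simp_rw [h1]
    rw [IsSubordinator.integral_exp_neg hτ _ (by positivity), Real.coe_toNNReal _ (by positivity),
      mul_sub, ← Real.mul_rpow hl.le (by positivity), mul_add, mul_div_cancel₀ _ hl.ne']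
    ring_nf

theorem gammaMeasure_eq_restrict_Ioi (ν l : ℝ) :
    gammaMeasure ν l = (volume.restrict (Ioi 0)).withDensity
      (fun u => ENNReal.ofReal (l ^ ν * u ^ (ν - 1) * Real.exp (-(l * u)) / Real.Gamma ν)) := by
  rw [gammaMeasure, withDensity_eq_restrict_Ioi (ae_pos_gammaMeasure ν l)]
  refine withDensity_congr_ae ?_
  filter_upwards [ae_restrict_mem measurableSet_Ioi] with u hu
  rw [gammaPDF_of_nonneg (le_of_lt hu)]
  ring_nf

theorem gammaMeasure_prod_tilted (hμ : IsPositiveStableLaw α μ) (hf : IsDensityOf f μ) {ν l : ℝ}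
    (hν : 0 < ν) (hl : 0 < l) :
    (gammaMeasure ν l).prod
      (μ.withDensity fun s => ENNReal.ofReal (Real.exp (l ^ α) * Real.exp (-(l * s)))) =
    ((volume : Measure (ℝ × ℝ)).restrict (Ioi 0 ×ˢ Ioi 0)).withDensity
      (fun p => ENNReal.ofReal (pairDensity α ν l f p.1 p.2)) := by
  have hfm := hf.measurable
  have h := ae_pos_tilted hμ l
  have h1 := tilted_eq_withDensity (α := α) hf l
  rw [← h1] at h ⊢
  rw [withDensity_eq_restrict_Ioi h, gammaMeasure_eq_restrict_Ioi,
    prod_withDensity (by fun_prop) (by fun_prop), Measure.prod_restrict, ← Measure.volume_eq_prod]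
  refine withDensity_congr_ae ?_
  filter_upwards [ae_restrict_mem (measurableSet_Ioi.prod measurableSet_Ioi)] with p hp
  have := Real.Gamma_pos_of_pos hν
  have : 0 < p.1 := hp.1
  rw [← ENNReal.ofReal_mul (by positivity)]
  rfl

end Density

end

/-! ### The integral identity for the fractional integral. -/

section

/-- Tonelli on the wedge `0 < s < t`, after the translation `t = u + s`. -/
theorem lintegral_Ioi_Ioi_eq_lintegral_Ioo {F : ℝ → ℝ → ℝ≥0∞}
    (hF : Measurable (Function.uncurry F)) :
    ∫⁻ s in Ioi (0 : ℝ), ∫⁻ u in Ioi (0 : ℝ), F u s =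
      ∫⁻ t in Ioi (0 : ℝ), ∫⁻ s in Ioo 0 t, F (t - s) s := by
  let D : ℝ → ℝ → ℝ≥0∞ := fun t s =>
    {p : ℝ × ℝ | 0 < p.2 ∧ p.2 < p.1}.indicator (fun p => F (p.1 - p.2) p.2) (t, s)
  have hD : Measurable (Function.uncurry D) := by
    refine Measurable.indicator (hF.comp (f := fun p : ℝ × ℝ => (p.1 - p.2, p.2)) (by fun_prop)) ?_
    exact (measurableSet_lt measurable_const measurable_snd).inter
      (measurableSet_lt measurable_snd measurable_fst)
  have h1 : ∫⁻ s in Ioi (0 : ℝ), ∫⁻ u in Ioi (0 : ℝ), F u s = ∫⁻ s, ∫⁻ t, D t s := by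
    rw [← lintegral_indicator measurableSet_Ioi]
    refine lintegral_congr fun s => ?_
    by_cases hs : 0 < s
    · rw [indicator_of_mem (mem_Ioi.2 hs), ← lintegral_indicator measurableSet_Ioi,
        ← lintegral_sub_right_eq_self _ s]
      refine lintegral_congr fun t => ?_
      by_cases ht : s < t
      · simp [D, hs, ht]
      · simp [D, ht]
    · simp [D, hs]
  have h2 : ∫⁻ t in Ioi (0 : ℝ), ∫⁻ s in Ioo 0 t, F (t - s) s = ∫⁻ t, ∫⁻ s, D t s := by
    rw [← lintegral_indicator measurableSet_Ioi]
    refine lintegral_congr fun t => ?_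
    by_cases ht : 0 < t
    · rw [indicator_of_mem (mem_Ioi.2 ht), ← lintegral_indicator measurableSet_Ioo]
      exact lintegral_congr fun s => rfl
    · have : ∀ s, D t s = 0 := fun s => by
        refine indicator_of_notMem (fun h => ht ?_) _
        exact h.1.trans h.2
      simp [this, ht]
  rw [h1, h2, lintegral_lintegral_swap (f := fun s t => D t s)
    (hD.comp measurable_swap).aemeasurable]

variable {α ν : ℝ} {μ : Measure ℝ} {f : ℝ → ℝ}

theorem measurable_pairDensity (hf : Measurable f) (l : ℝ) :
    Measurable (Function.uncurry (pairDensity α ν l f)) := by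
  unfold pairDensity Function.uncurry
  fun_prop

theorem pairDensity_nonneg (hν : 0 < ν) (hf : IsDensityOf f μ) {l u s : ℝ} (hl : 0 < l)
    (hu : 0 < u) : 0 ≤ pairDensity α ν l f u s := by
  have := Real.Gamma_pos_of_pos hν
  have := hf.nonneg s
  unfold pairDensity
  positivity

theorem lintegral_withDensity_pairDensity (hν : 0 < ν) (hf : IsDensityOf f μ) {l : ℝ}
    (hl : 0 < l) {h : ℝ → ℝ} (hh : Measurable h) :
    ∫⁻ p, ENNReal.ofReal (h (p.1 + p.2))
      ∂(((volume : Measure (ℝ × ℝ)).restrict (Ioi 0 ×ˢ Ioi 0)).withDensity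
        (fun p => ENNReal.ofReal (pairDensity α ν l f p.1 p.2))) =
    ∫⁻ s in Ioi (0 : ℝ), ∫⁻ u in Ioi (0 : ℝ),
      ENNReal.ofReal (h (u + s) * pairDensity α ν l f u s) := by
  have hp := measurable_pairDensity (α := α) (ν := ν) hf.measurable l
  have hp' : Measurable fun p : ℝ × ℝ => ENNReal.ofReal (pairDensity α ν l f p.1 p.2) :=
    hp.ennreal_ofReal
  have hh' : Measurable fun p : ℝ × ℝ => ENNReal.ofReal (h (p.1 + p.2)) := by fun_prop
  rw [lintegral_withDensity_eq_lintegral_mul _ hp' hh', Measure.volume_eq_prod,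
    ← Measure.prod_restrict, lintegral_prod_symm _ (hp'.mul hh').aemeasurable]
  refine lintegral_congr fun s => setLIntegral_congr_fun measurableSet_Ioi fun u hu => ?_
  rw [Pi.mul_apply, mul_comm (h _), ENNReal.ofReal_mul (pairDensity_nonneg hν hf hl hu)]

theorem lintegral_pairDensity_eq (hν : 0 < ν) (hf : IsDensityOf f μ) {l : ℝ} (hl : 0 < l)
    {h : ℝ → ℝ} (hh : Measurable h) (h0 : ∀ t, 0 < t → 0 ≤ h t) :
    ∫⁻ s in Ioi (0 : ℝ), ∫⁻ u in Ioi (0 : ℝ),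
      ENNReal.ofReal (h (u + s) * pairDensity α ν l f u s) =
    ∫⁻ t in Ioi (0 : ℝ), ENNReal.ofReal
        (l ^ ν * Real.exp (l ^ α) / Real.Gamma ν * (Real.exp (-(l * t)) * h t)) *
      ∫⁻ s in Ioo 0 t, ENNReal.ofReal (f s * (t - s) ^ (ν - 1)) := by
  have hp := measurable_pairDensity (α := α) (ν := ν) hf.measurable l
  have hfm := hf.measurable
  rw [lintegral_Ioi_Ioi_eq_lintegral_Ioo
    (F := fun u s => ENNReal.ofReal (h (u + s) * pairDensity α ν l f u s))
    (Measurable.ennreal_ofReal ((by fun_prop :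
      Measurable fun p : ℝ × ℝ => h (p.1 + p.2)).mul hp))]
  refine setLIntegral_congr_fun measurableSet_Ioi fun t ht => ?_
  have hΓ := Real.Gamma_pos_of_pos hν
  have ht0 := h0 t ht
  rw [← lintegral_const_mul _ (by fun_prop)]
  refine setLIntegral_congr_fun measurableSet_Ioo fun s hs => ?_
  rw [← ENNReal.ofReal_mul (by positivity), sub_add_cancel]
  congr 1
  have : Real.exp (-(l * t)) = Real.exp (-(l * (t - s))) * Real.exp (-(l * s)) := by
    rw [← Real.exp_add]; ring_nf
  rw [this]
  unfold pairDensity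
  ring

/-- `rlIntegral` is a Bochner integral, with the default value `0` if the integrand is not
integrable, so finiteness must be known. Taking `h = 1` and `l = 1` in `lintegral_pairDensity_eq`,
the left side is the total mass `1` of a probability law; since the weight is positive, the inner
integral is finite almost everywhere. -/
theorem ae_lintegral_Ioo_lt_top (hμ : IsPositiveStableLaw α μ) (hν : 0 < ν)
    (hf : IsDensityOf f μ) : ∀ᵐ t ∂(volume.restrict (Ioi (0 : ℝ))),
      ∫⁻ s in Ioo 0 t, ENNReal.ofReal (f s * (t - s) ^ (ν - 1)) < ∞ := by
  have h1 := lintegral_pairDensity_eq (α := α) hν hf one_pos (h := fun _ => 1) (by fun_prop)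
    fun _ _ => zero_le_one
  rw [← lintegral_withDensity_pairDensity (α := α) (h := fun _ => 1) hν hf one_pos (by fun_prop),
    ← gammaMeasure_prod_tilted hμ hf hν one_pos] at h1
  have := isProbabilityMeasure_gammaMeasure hν one_pos
  have := isProbabilityMeasure_tilted hμ zero_le_one
  simp only [ENNReal.ofReal_one, lintegral_const, measure_univ, mul_one] at h1
  have hfm := hf.measurable
  have hm : Measurable fun t : ℝ =>
      ∫⁻ s in Ioo 0 t, ENNReal.ofReal (f s * (t - s) ^ (ν - 1)) := by
    simp_rw [← lintegral_indicator measurableSet_Ioo]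
    refine Measurable.lintegral_prod_right' (f := fun p : ℝ × ℝ => (Ioo 0 p.1).indicator
      (fun s => ENNReal.ofReal (f s * (p.1 - s) ^ (ν - 1))) p.2) ?_
    have hS : MeasurableSet {p : ℝ × ℝ | 0 < p.2 ∧ p.2 < p.1} :=
      (measurableSet_lt measurable_const measurable_snd).inter
        (measurableSet_lt measurable_snd measurable_fst)
    exact Measurable.indicator (f := fun p : ℝ × ℝ =>
      ENNReal.ofReal (f p.2 * (p.1 - p.2) ^ (ν - 1))) (by fun_prop) hS
  have h2 := ae_lt_top (μ := volume.restrict (Ioi (0 : ℝ))) (Measurable.mul (by fun_prop) hm)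
    (h1.symm.trans_ne ENNReal.one_ne_top)
  filter_upwards [h2] with t ht
  refine lt_top_iff_ne_top.2 fun h => ?_
  rw [Pi.mul_apply, h, ENNReal.mul_top] at ht
  · exact lt_irrefl _ ht
  · have := Real.Gamma_pos_of_pos hν
    exact (ENNReal.ofReal_pos.2 (by positivity)).ne'

theorem lintegral_rlIntegral_eq (hμ : IsPositiveStableLaw α μ) (hν : 0 < ν)
    (hf : IsDensityOf f μ) {l : ℝ} (hl : 0 < l)
    {h : ℝ → ℝ} (hh : Measurable h) (h0 : ∀ t, 0 < t → 0 ≤ h t) :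
    ∫⁻ t in Ioi (0 : ℝ), ENNReal.ofReal (Real.exp (-(l * t)) * h t * rlIntegral ν f t) =
      ENNReal.ofReal (1 / (l ^ ν * Real.exp (l ^ α))) *
        ∫⁻ s in Ioi (0 : ℝ), ∫⁻ u in Ioi (0 : ℝ),
          ENNReal.ofReal (h (u + s) * pairDensity α ν l f u s) := by
  have hfm := hf.measurable
  have hΓ := Real.Gamma_pos_of_pos hν
  rw [lintegral_pairDensity_eq hν hf hl hh h0, ← lintegral_const_mul' _ _ ENNReal.ofReal_ne_top]
  refine lintegral_congr_ae ?_
  filter_upwards [ae_restrict_mem measurableSet_Ioi, ae_lintegral_Ioo_lt_top hμ hν hf]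
    with t ht hfin
  have hnn : ∀ᵐ s ∂(volume.restrict (Ioo 0 t)), 0 ≤ f s * (t - s) ^ (ν - 1) := by
    filter_upwards [ae_restrict_mem measurableSet_Ioo] with s hs
    have := sub_pos.2 hs.2
    have := hf.nonneg s
    positivity
  have hint : Integrable (fun s => f s * (t - s) ^ (ν - 1)) (volume.restrict (Ioo 0 t)) :=
    ⟨by fun_prop, (hasFiniteIntegral_iff_ofReal hnn).2 hfin⟩
  have ht0 := h0 t ht
  rw [← ofReal_integral_eq_lintegral_ofReal hint hnn, ← ENNReal.ofReal_mul (by positivity),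
    ← ENNReal.ofReal_mul (by positivity), rlIntegral]
  congr 1
  have : 0 < l ^ ν := by positivity
  field_simp

theorem lintegral_ofReal_eq_one (hμ : IsPositiveStableLaw α μ) (hf : IsDensityOf f μ) {h : ℝ → ℝ}
    (hh : Measurable h)
    (h1 : ∫⁻ t in Ioi (0 : ℝ), ENNReal.ofReal (h t * f t) = 1) :
    ∫⁻ x, ENNReal.ofReal (h x) ∂μ = 1 := by
  have hfm := hf.measurable
  have hp := hμ.pos
  rw [← hf.withDensity_eq] at hp
  rw [← hf.withDensity_eq, withDensity_eq_restrict_Ioi hp,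
    lintegral_withDensity_eq_lintegral_mul _ (by fun_prop) (by fun_prop), ← h1]
  refine lintegral_congr fun t => ?_
  rw [Pi.mul_apply, mul_comm (h t), ENNReal.ofReal_mul (hf.nonneg t)]

end

/-! ### Tools for the failure of independence. -/

section

variable {Ω : Type*} [MeasurableSpace Ω] {P : Measure Ω} [IsProbabilityMeasure P]

theorem lintegral_comp_mul_comp_of_indepFun {β β' : Type*} [MeasurableSpace β] [MeasurableSpace β']
    {P : Measure Ω} {A : Ω → β} {B : Ω → β'} (hA : AEMeasurable A P) (hB : AEMeasurable B P) (hi : IndepFun A B P)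
    {φ : β → ℝ≥0∞} {ψ : β' → ℝ≥0∞} (hφ : Measurable φ) (hψ : Measurable ψ) :
    ∫⁻ ω, φ (A ω) * ψ (B ω) ∂P = (∫⁻ ω, φ (A ω) ∂P) * ∫⁻ ω, ψ (B ω) ∂P :=
  lintegral_mul_eq_lintegral_mul_lintegral_of_indepFun'' (hφ.comp_aemeasurable hA)
    (hψ.comp_aemeasurable hB) (hi.comp hφ hψ)

/-- The variance vanishes. Stated with integrals in `[0, ∞]`, so that square integrability is a
consequence of the identity and not an assumption. -/
theorem ae_eq_const_of_lintegral_sq {V : Ω → ℝ} (hV : AEMeasurable V P) (h0 : ∀ᵐ ω ∂P, 0 ≤ V ω)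
    (hfin : ∫⁻ ω, ENNReal.ofReal (V ω) ∂P < ∞)
    (h : ∫⁻ ω, ENNReal.ofReal (V ω) * ENNReal.ofReal (V ω) ∂P =
      (∫⁻ ω, ENNReal.ofReal (V ω) ∂P) * ∫⁻ ω, ENNReal.ofReal (V ω) ∂P) :
    ∃ c, V =ᵐ[P] fun _ => c := by
  have h2 : ∀ᵐ ω ∂P, ENNReal.ofReal (V ω) * ENNReal.ofReal (V ω) = ENNReal.ofReal ((V ^ 2) ω) := by
    filter_upwards [h0] with ω hω
    rw [← ENNReal.ofReal_mul hω, Pi.pow_apply, sq]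
  rw [lintegral_congr_ae h2] at h
  have hsq : Integrable (V ^ 2) P := by
    refine ⟨by fun_prop, (hasFiniteIntegral_iff_ofReal (ae_of_all _ fun ω => sq_nonneg _)).2 ?_⟩
    exact h.trans_lt (ENNReal.mul_lt_top hfin hfin)
  have hL : MemLp V 2 P := (memLp_two_iff_integrable_sq hV.aestronglyMeasurable).2 hsq
  have hvar : variance V P = 0 := by
    rw [variance_eq_sub hL, integral_eq_lintegral_of_nonneg_ae (f := V ^ 2)
      (ae_of_all _ fun ω => sq_nonneg (V ω)) (by fun_prop), h, integral_eq_lintegral_of_nonneg_ae h0 (by fun_prop), ENNReal.toReal_mul]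
    ring
  refine ⟨_, (evariance_eq_zero_iff hV).1 ?_⟩
  rw [← hL.ofReal_variance_eq, hvar, ENNReal.ofReal_zero]

/-- The quotient of two independent positive variables with finite means is not independent of
the denominator, unless the denominator is constant. -/
theorem not_indepFun_div {U V : Ω → ℝ} (hU : AEMeasurable U P) (hV : AEMeasurable V P)
    (hU0 : ∀ᵐ ω ∂P, 0 < U ω) (hV0 : ∀ᵐ ω ∂P, 0 < V ω)
    (hUfin : ∫⁻ ω, ENNReal.ofReal (U ω) ∂P < ∞) (hVfin : ∫⁻ ω, ENNReal.ofReal (V ω) ∂P < ∞)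
    (hUV : IndepFun U V P) (hconst : ∀ c, ¬ V =ᵐ[P] fun _ => c) :
    ¬ IndepFun (fun ω => U ω / V ω) V P := by
  intro hi
  have hW : AEMeasurable (fun ω => U ω / V ω) P := hU.div hV
  have hW0 : ∀ᵐ ω ∂P, 0 < U ω / V ω := by
    filter_upwards [hU0, hV0] with ω h1 h2 using div_pos h1 h2
  have hpos : ∀ {X : Ω → ℝ}, AEMeasurable X P → (∀ᵐ ω ∂P, 0 < X ω) →
      ∫⁻ ω, ENNReal.ofReal (X ω) ∂P ≠ 0 := by
    intro X hX hX0 h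
    rw [lintegral_eq_zero_iff' (by fun_prop)] at h
    obtain ⟨ω, h1, h2⟩ := (h.and hX0).exists
    exact absurd (ENNReal.ofReal_eq_zero.1 h1) (not_le.2 h2)
  -- With `W = U / V`, assumed independent of `V`, `e1` is `E[U] = E[W] E[V]` and `e2` is `E[U] E[V]
  -- = E[W] E[V²]`. Cancelling `E[W]`, which is positive and finite, leaves `E[V²] = (E[V])²`.
  have e1 : ∫⁻ ω, ENNReal.ofReal (U ω) ∂P =
      (∫⁻ ω, ENNReal.ofReal (U ω / V ω) ∂P) * ∫⁻ ω, ENNReal.ofReal (V ω) ∂P := by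
    rw [← lintegral_comp_mul_comp_of_indepFun hW hV hi ENNReal.measurable_ofReal
      ENNReal.measurable_ofReal]
    refine lintegral_congr_ae ?_
    filter_upwards [hV0, hW0] with ω h1 h2
    rw [← ENNReal.ofReal_mul h2.le, div_mul_cancel₀ _ h1.ne']
  have e2 : (∫⁻ ω, ENNReal.ofReal (U ω) ∂P) * ∫⁻ ω, ENNReal.ofReal (V ω) ∂P =
      (∫⁻ ω, ENNReal.ofReal (U ω / V ω) ∂P) *
        ∫⁻ ω, ENNReal.ofReal (V ω) * ENNReal.ofReal (V ω) ∂P := by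
    rw [← lintegral_comp_mul_comp_of_indepFun hU hV hUV ENNReal.measurable_ofReal
      ENNReal.measurable_ofReal,
      ← lintegral_comp_mul_comp_of_indepFun hW hV hi ENNReal.measurable_ofReal
        (ψ := fun x => ENNReal.ofReal x * ENNReal.ofReal x) (by fun_prop)]
    refine lintegral_congr_ae ?_
    filter_upwards [hV0, hW0] with ω h1 h2
    rw [← mul_assoc, ← ENNReal.ofReal_mul h2.le, div_mul_cancel₀ _ h1.ne']
  have hWne : ∫⁻ ω, ENNReal.ofReal (U ω / V ω) ∂P ≠ ∞ := by
    intro h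
    rw [h, ENNReal.top_mul (hpos hV hV0)] at e1
    exact hUfin.ne e1
  rw [e1, mul_assoc] at e2
  obtain ⟨c, hc⟩ := ae_eq_const_of_lintegral_sq hV (hV0.mono fun _ h => h.le) hVfin
    ((ENNReal.mul_right_inj (hpos hW hW0) hWne).1 e2).symm
  exact hconst c hc

theorem not_ae_eq_const_of_map_absolutelyContinuous {X : Ω → ℝ}
    (h : P.map X ≪ volume) (c : ℝ) : ¬ X =ᵐ[P] fun _ => c := by
  intro hc
  have h1 : P.map X {c} = 0 := h Real.volume_singleton
  rw [Measure.map_congr hc, Measure.map_const] at h1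
  simp at h1

/-- For `x < y`, both `y` and `x + 1` are convex combinations of `x` and `y + 1`, with the weights
exchanged. Adding the two strict concavity inequalities gives the claim. -/
theorem strictAntiOn_add_one_rpow_sub_rpow {α : ℝ} (hα0 : 0 < α) (hα1 : α < 1) :
    StrictAntiOn (fun x : ℝ => (x + 1) ^ α - x ^ α) (Ici 0) := by
  intro x hx y hy hxy
  have hx : 0 ≤ x := hx
  have hy : 0 ≤ y := hy
  have hd : 0 < y + 1 - x := by linarith
  have key : ∀ a b : ℝ, 0 < a → 0 < b → a + b = 1 →
      a * x ^ α + b * (y + 1) ^ α < (a * x + b * (y + 1)) ^ α := fun a b ha hb hab =>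
    (Real.strictConcaveOn_rpow hα0 hα1).2 (mem_Ici.2 hx) (mem_Ici.2 (by positivity : 0 ≤ y + 1))
      (by linarith) ha hb hab
  have h1 := key (1 / (y + 1 - x)) ((y - x) / (y + 1 - x)) (by positivity)
    (div_pos (by linarith) hd) (by field_simp; ring)
  have h2 := key ((y - x) / (y + 1 - x)) (1 / (y + 1 - x)) (div_pos (by linarith) hd)
    (by positivity) (by field_simp; ring)
  have e1 : 1 / (y + 1 - x) * x + (y - x) / (y + 1 - x) * (y + 1) = y := by
    field_simp; ring
  have e2 : (y - x) / (y + 1 - x) * x + 1 / (y + 1 - x) * (y + 1) = x + 1 := by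
    field_simp; ring
  have e3 : 1 / (y + 1 - x) + (y - x) / (y + 1 - x) = 1 := by field_simp; ring
  rw [e1] at h1
  rw [e2] at h2
  have e4 : (y - x) / (y + 1 - x) = 1 - 1 / (y + 1 - x) := by linarith
  rw [e4] at h1 h2
  dsimp only
  linarith

theorem injOn_exp_mul_rpow {α : ℝ} (hα0 : 0 < α) (hα1 : α < 1) :
    InjOn (fun h : ℝ => Real.exp (-(h * ((1 + 1 / h ^ (1 / α)) ^ α - 1)))) (Ioi 0) := by
  -- In the variable `x = h ^ (1 / α)` the exponent is the strictly decreasing function `(x + 1) ^ α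
  -- - x ^ α`.
  have e : ∀ h : ℝ, 0 < h → h * ((1 + 1 / h ^ (1 / α)) ^ α - 1) =
      (h ^ (1 / α) + 1) ^ α - (h ^ (1 / α)) ^ α := by
    intro h hh
    have hp : 0 < h ^ (1 / α) := by positivity
    have h1 : (h ^ (1 / α)) ^ α = h := by
      rw [← Real.rpow_mul hh.le, one_div_mul_cancel hα0.ne', Real.rpow_one]
    have h2 : h ^ (1 / α) + 1 = h ^ (1 / α) * (1 + 1 / h ^ (1 / α)) := by field_simp
    rw [h2, Real.mul_rpow hp.le (by positivity), h1]
    ring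
  intro a ha b hb hab
  have ha : 0 < a := ha
  have hb : 0 < b := hb
  have h1 := neg_injective (Real.exp_injective hab)
  rw [e a ha, e b hb] at h1
  have h2 := (strictAntiOn_add_one_rpow_sub_rpow hα0 hα1).injOn
    (mem_Ici.2 (by positivity)) (mem_Ici.2 (by positivity)) h1
  exact (Real.rpow_left_inj ha.le hb.le (by positivity)).1 h2

/-- A generalized gamma subordinator at an independent, nonconstant positive time `X`, normalised
by `X ^ (1 / α)`, is not independent of `X`. -/
theorem not_indepFun_eval_div_rpow {α : ℝ} (hα0 : 0 < α) (hα1 : α < 1) {τ : ℝ≥0 → Ω → ℝ}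
    (hτ : IsGenGammaSubordinator α τ P) {X : Ω → ℝ≥0} (hX : AEMeasurable X P)
    (hX0 : ∀ᵐ ω ∂P, 0 < X ω) (hXi : IndepFun X (fun ω (t : ℝ≥0) => τ t ω) P)
    (hconst : ∀ c : ℝ, ¬ (fun ω => (X ω : ℝ)) =ᵐ[P] fun _ => c) :
    ¬ IndepFun (fun ω => τ (X ω) ω / (X ω : ℝ) ^ (1 / α)) X P := by
  intro hi
  -- `k x` is the Laplace transform at `1` of `τ(x) / x ^ (1 / α)`. Testing against `φ = 1` and `φ =
  -- k` under independence yields `E[k(X)²] = (E[k(X)])²`, so `k(X)` is constant, and then `X` is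
  -- too because `k` is injective.
  let k : ℝ → ℝ := fun h => Real.exp (-(h * ((1 + 1 / h ^ (1 / α)) ^ α - 1)))
  have hk : Measurable fun x : ℝ≥0 => k x := by fun_prop
  have hkX : AEMeasurable (fun ω => k (X ω)) P := hk.comp_aemeasurable hX
  have hW : AEMeasurable (fun ω => τ (X ω) ω / (X ω : ℝ) ^ (1 / α)) P :=
    (IsSubordinator.aemeasurable_eval hτ hX).div (by fun_prop)
  have key : ∀ φ : ℝ≥0 → ℝ≥0∞, Measurable φ →
      ∫⁻ ω, ENNReal.ofReal (Real.exp (-(τ (X ω) ω / (X ω : ℝ) ^ (1 / α)))) * φ (X ω) ∂P =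
        ∫⁻ ω, ENNReal.ofReal (k (X ω)) * φ (X ω) ∂P := by
    intro φ hφ
    rw [IsSubordinator.lintegral_comp_eval hτ hX hXi
      (F := fun x z => ENNReal.ofReal (Real.exp (-(z / (x : ℝ) ^ (1 / α)))) * φ x)
      (by unfold Function.uncurry; fun_prop),
      ← lintegral_map' (f := fun x : ℝ≥0 => ENNReal.ofReal (k x) * φ x) (by fun_prop) hX]
    refine lintegral_congr fun x => ?_
    have hm := hτ.measurable
    rw [lintegral_mul_const _ (by fun_prop)]
    congr 1
    have e : ∀ z : ℝ, z / (x : ℝ) ^ (1 / α) = 1 / (x : ℝ) ^ (1 / α) * z := fun z => by ring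
    refine (lintegral_congr fun ω => ?_).trans <| IsSubordinator.lintegral_exp_neg hτ x
      (y := 1 / (x : ℝ) ^ (1 / α)) (by positivity)
    rw [e]
  have e1 := key (fun _ => 1) measurable_const
  have e2 := key (fun x => ENNReal.ofReal (k x)) (by fun_prop)
  simp only [mul_one] at e1
  have hfin : ∫⁻ ω, ENNReal.ofReal (k (X ω)) ∂P < ∞ := by
    refine (lintegral_mono (g := fun _ => 1) fun ω => ?_).trans_lt (by simp)
    refine ENNReal.ofReal_le_one.2 (Real.exp_le_one_iff.2 (neg_nonpos.2 ?_))
    refine mul_nonneg (NNReal.coe_nonneg _) (sub_nonneg.2 (Real.one_le_rpow ?_ hα0.le))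
    have : (0 : ℝ) ≤ 1 / (X ω : ℝ) ^ (1 / α) := by positivity
    linarith
  rw [lintegral_comp_mul_comp_of_indepFun hW hX hi
    (φ := fun z => ENNReal.ofReal (Real.exp (-z)))
    (ψ := fun x : ℝ≥0 => ENNReal.ofReal (k x)) (by fun_prop) (by fun_prop), e1] at e2
  obtain ⟨c, hc⟩ := ae_eq_const_of_lintegral_sq hkX (ae_of_all _ fun _ => (Real.exp_pos _).le)
    hfin e2.symm
  obtain ⟨ω₀, h1, h2⟩ := (hc.and hX0).exists
  refine hconst (X ω₀) ?_
  filter_upwards [hc, hX0] with ω h3 h4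
  exact injOn_exp_mul_rpow hα0 hα1 (mem_Ioi.2 (NNReal.coe_pos.2 h4))
    (mem_Ioi.2 (NNReal.coe_pos.2 h2)) (h3.trans h1.symm)

/-- The tilt bounds `s * exp (-l s)` by `1 / l`, so no moment of `μ` itself is needed. -/
theorem lintegral_id_tilted_lt_top {α : ℝ} {μ : Measure ℝ} (hμ : IsPositiveStableLaw α μ) {l : ℝ}
    (hl : 0 < l) :
    ∫⁻ s, ENNReal.ofReal s
      ∂(μ.withDensity fun s => ENNReal.ofReal (Real.exp (l ^ α) * Real.exp (-(l * s)))) < ∞ := by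
  have := hμ.isProbabilityMeasure
  rw [lintegral_withDensity_eq_lintegral_mul _ (by fun_prop) (by fun_prop)]
  refine (lintegral_mono (g := fun _ => ENNReal.ofReal (Real.exp (l ^ α) / l)) fun s => ?_).trans_lt
    (by simp)
  rw [Pi.mul_apply, ← ENNReal.ofReal_mul (by positivity), mul_assoc, div_eq_mul_inv]
  refine ENNReal.ofReal_le_ofReal (mul_le_mul_of_nonneg_left ?_ (Real.exp_pos _).le)
  rw [Real.exp_neg, inv_mul_eq_div, div_le_iff₀ (Real.exp_pos _), inv_mul_eq_div, le_div_iff₀ hl]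
  have := Real.add_one_le_exp (l * s)
  linarith

end

/-! ### Assembly of the four statements. -/

theorem mainTheorem3
    (α ν : ℝ) (hα0 : 0 < α) (hα1 : α < 1) (hν : 0 < ν)
    (μ : Measure ℝ) (hμ : IsPositiveStableLaw α μ)
    (f : ℝ → ℝ) (hf : IsDensityOf f μ)
    {Ω : Type*} [MeasurableSpace Ω] (P : Measure Ω) [IsProbabilityMeasure P]
    (τ τ' : ℝ≥0 → Ω → ℝ)
    (hτ : IsGenGammaSubordinator α τ P) (hτ' : IsGenGammaSubordinator α τ' P)
    (Gν G : Ω → ℝ)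
    (hGν : HasLaw Gν (gammaMeasure ν 1) P) (hG : HasLaw G (gammaMeasure (ν / α) 1) P)
    -- `Gν` is independent of `τ`
    (hGντ : IndepFun Gν (fun ω (t : ℝ≥0) => τ t ω) P)
    -- `G`, `τ`, `τ'` are mutually independent
    (hττ' : IndepFun (fun ω (t : ℝ≥0) => τ t ω) (fun ω (t : ℝ≥0) => τ' t ω) P)
    (hGττ' : IndepFun G (fun ω => ((fun t : ℝ≥0 => τ t ω), (fun t : ℝ≥0 => τ' t ω))) P) :
    -- the integral identity, as an identity in `[0, ∞]`
    (∀ h : ℝ → ℝ, Measurable h → (∀ t, 0 < t → 0 ≤ h t) →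
      ∫⁻ t in Ioi (0 : ℝ), ENNReal.ofReal (h t * f t) = 1 →
      ∫⁻ x, ENNReal.ofReal (h x) ∂μ = 1 ∧
      ∀ l : ℝ, 0 < l →
        ∫⁻ t in Ioi (0 : ℝ), ENNReal.ofReal (Real.exp (-(l * t)) * h t * rlIntegral ν f t) =
          ENNReal.ofReal (1 / (l ^ ν * Real.exp (l ^ α))) *
            ∫⁻ s in Ioi (0 : ℝ), ∫⁻ u in Ioi (0 : ℝ),
              ENNReal.ofReal (h (u + s) * pairDensity α ν l f u s) ∧
        ∫⁻ t in Ioi (0 : ℝ), ENNReal.ofReal (Real.exp (-(l * t)) * h t * rlIntegral ν f t) =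
          ENNReal.ofReal (1 / (l ^ ν * Real.exp (l ^ α))) *
            ∫⁻ ω, ENNReal.ofReal (h (Gν ω / l + evalAt τ (fun _ => l ^ α) ω / l)) ∂P ∧
        ∫⁻ t in Ioi (0 : ℝ), ENNReal.ofReal (Real.exp (-(l * t)) * h t * rlIntegral ν f t) =
          ENNReal.ofReal (1 / (l ^ ν * Real.exp (l ^ α))) *
            ∫⁻ ω, ENNReal.ofReal (h (tildeS α τ G l ω)) ∂P) ∧
    -- the three independent pairs, with the common joint density
    (∀ l : ℝ, 0 < l →
      HasLaw (fun ω => (Gν ω / l, evalAt τ (fun _ => l ^ α) ω / l))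
        (((volume : Measure (ℝ × ℝ)).restrict (Ioi 0 ×ˢ Ioi 0)).withDensity
          (fun p => ENNReal.ofReal (pairDensity α ν l f p.1 p.2))) P ∧
      HasLaw (fun ω => (evalAt τ' G ω / l, evalAt τ (fun _ => l ^ α) ω / l))
        (((volume : Measure (ℝ × ℝ)).restrict (Ioi 0 ×ˢ Ioi 0)).withDensity
          (fun p => ENNReal.ofReal (pairDensity α ν l f p.1 p.2))) P ∧
      HasLaw (fun ω => ((evalAt τ (fun ω' => G ω' + l ^ α) ω - evalAt τ (fun _ => l ^ α) ω) / l,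
          evalAt τ (fun _ => l ^ α) ω / l))
        (((volume : Measure (ℝ × ℝ)).restrict (Ioi 0 ×ˢ Ioi 0)).withDensity
          (fun p => ENNReal.ofReal (pairDensity α ν l f p.1 p.2))) P) ∧
    -- equality in law of the process `tildeS` and of the processes of sums
    (∀ (n : ℕ) (l : Fin n → ℝ), (∀ i, 0 < l i) →
      IdentDistrib (fun ω i => tildeS α τ G (l i) ω)
        (fun ω i => (evalAt τ' G ω + evalAt τ (fun _ => l i ^ α) ω) / l i) P P ∧
      IdentDistrib (fun ω i => tildeS α τ G (l i) ω)
        (fun ω i => Gν ω / l i + evalAt τ (fun _ => l i ^ α) ω / l i) P P) ∧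
    -- the product decompositions, whose factors are not independent
    (∀ l : ℝ, 0 < l →
      (∀ᵐ ω ∂P, tildeS α τ G l ω =
        evalAt τ (fun ω' => G ω' + l ^ α) ω / evalAt τ (fun _ => l ^ α) ω *
          (evalAt τ (fun _ => l ^ α) ω / l)) ∧
      (∀ᵐ ω ∂P, tildeS α τ G l ω =
        evalAt τ (fun ω' => G ω' + l ^ α) ω / (G ω + l ^ α) ^ (1 / α) *
          ((G ω + l ^ α) / l ^ α) ^ (1 / α)) ∧
      ¬ IndepFun
        (fun ω => evalAt τ (fun ω' => G ω' + l ^ α) ω / evalAt τ (fun _ => l ^ α) ω)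
        (fun ω => evalAt τ (fun _ => l ^ α) ω / l) P ∧
      ¬ IndepFun
        (fun ω => evalAt τ (fun ω' => G ω' + l ^ α) ω / (G ω + l ^ α) ^ (1 / α))
        (fun ω => ((G ω + l ^ α) / l ^ α) ^ (1 / α)) P) := by
  have hGνm := hGν.aemeasurable
  have hGm := hG.aemeasurable
  have hτm := hτ.measurable
  have hpτ := IsSubordinator.measurable_path hτ
  have hpτ' := IsSubordinator.measurable_path hτ'
  have hG0 : ∀ᵐ ω ∂P, 0 < G ω :=
    (hG.ae_iff (p := fun x => 0 < x) (measurableSet_setOfPred.1 measurableSet_Ioi)).2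
      (ae_pos_gammaMeasure _ _)
  have hX : AEMeasurable (fun ω => (G ω).toNNReal) P := by fun_prop
  have hXi : IndepFun (fun ω => (G ω).toNNReal)
      (fun ω => ((fun t : ℝ≥0 => τ t ω), (fun t : ℝ≥0 => τ' t ω))) P :=
    hGττ'.comp measurable_real_toNNReal measurable_id
  have hGτ : IndepFun G (fun ω (t : ℝ≥0) => τ t ω) P := hGττ'.comp measurable_id measurable_fst
  have hGτ' : IndepFun G (fun ω (t : ℝ≥0) => τ' t ω) P := hGττ'.comp measurable_id measurable_snd
  have hE : AEMeasurable (evalAt τ' G) P := IsSubordinator.aemeasurable_eval hτ' hX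
  have hElaw : IdentDistrib (evalAt τ' G) Gν P P :=
    ⟨hE, hGνm, (map_eval_eq_gammaMeasure hα0 hν hτ' hG hGτ').trans hGν.map_eq.symm⟩
  have hEτ : IndepFun (evalAt τ' G) (fun ω (t : ℝ≥0) => τ t ω) P := by
    refine (indepFun_prodMk_of_indepFun hX hpτ.aemeasurable hpτ'.aemeasurable hττ' hXi).comp
      measurable_pathEval measurable_id |>.congr ?_ (ae_of_all _ fun _ => rfl)
    filter_upwards [IsSubordinator.ae_pathEval hτ'] with ω hω using hω _
  -- `Real.toNNReal` is additive only on nonnegative reals, hence the almost sure positivity of `G`.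
  -- The exceptional set does not depend on `l`, as the finite-dimensional statement requires.
  have hadd : ∀ᵐ ω ∂P, ∀ l : ℝ, 0 < l → evalAt τ (fun ω' => G ω' + l ^ α) ω =
      τ ((G ω).toNNReal + (l ^ α).toNNReal) ω := by
    filter_upwards [hG0] with ω hω l hl
    rw [evalAt, Real.toNNReal_add hω.le (by positivity)]
  have hpair : ∀ l : ℝ, 0 < l →
      HasLaw (fun ω => (Gν ω / l, evalAt τ (fun _ => l ^ α) ω / l))
        (((volume : Measure (ℝ × ℝ)).restrict (Ioi 0 ×ˢ Ioi 0)).withDensity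
          (fun p => ENNReal.ofReal (pairDensity α ν l f p.1 p.2))) P := by
    intro l hl
    rw [← gammaMeasure_prod_tilted hμ hf hν hl]
    have h1 : HasLaw (fun ω => Gν ω / l) (gammaMeasure ν l) P := by
      refine ⟨by fun_prop, ?_⟩
      rw [← map_div_gammaMeasure hν hl, ← hGν.map_eq,
        AEMeasurable.map_map_of_aemeasurable (by fun_prop) hGνm]
      rfl
    have h2 : HasLaw (fun ω => evalAt τ (fun _ => l ^ α) ω / l) _ P :=
      ⟨((hτm _).div_const l).aemeasurable, map_eval_div_eq_tilted hμ hτ hl⟩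
    exact IndepFun.hasLaw_prod h1 h2 (hGντ.comp (φ := fun x => x / l)
      (ψ := fun p : ℝ≥0 → ℝ => p (l ^ α).toNNReal / l) (by fun_prop) (by fun_prop))
  have hpair' : ∀ l : ℝ, 0 < l →
      IdentDistrib (fun ω => (Gν ω, evalAt τ (fun _ => l ^ α) ω))
        (fun ω => (evalAt τ' G ω, evalAt τ (fun _ => l ^ α) ω)) P P := by
    intro l hl
    exact hElaw.symm.prodMk (IdentDistrib.refl (hτm _).aemeasurable)
      (hGντ.comp (φ := id) (ψ := fun p : ℝ≥0 → ℝ => p (l ^ α).toNNReal) (by fun_prop)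
        (by fun_prop))
      (hEτ.comp (φ := id) (ψ := fun p : ℝ≥0 → ℝ => p (l ^ α).toNNReal) (by fun_prop)
        (by fun_prop))
  have hincr : ∀ l : ℝ, 0 < l →
      IdentDistrib (fun ω => (evalAt τ' G ω, evalAt τ (fun _ => l ^ α) ω))
        (fun ω => (evalAt τ (fun ω' => G ω' + l ^ α) ω - evalAt τ (fun _ => l ^ α) ω,
          evalAt τ (fun _ => l ^ α) ω)) P P := by
    intro l hl
    have h := IsSubordinator.identDistrib_increment hτ hτ' hττ' hX hXi (l ^ α).toNNReal
    refine h.symm.trans (IdentDistrib.of_ae_eq h.aemeasurable_fst ?_)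
    filter_upwards [hadd] with ω hω
    rw [hω l hl]
    rfl
  have hdiv : ∀ l : ℝ, Measurable fun p : ℝ × ℝ => (p.1 / l, p.2 / l) := fun l => by fun_prop
  have hpair2 := fun l hl => ((hpair' l hl).comp (hdiv l)).hasLaw (hpair l hl)
  have hpair3 := fun l hl => ((hincr l hl).comp (hdiv l)).hasLaw (hpair2 l hl)
  have hpos : ∀ l : ℝ, 0 < l → ∀ᵐ ω ∂P, 0 < evalAt τ (fun _ => l ^ α) ω / l := by
    intro l hl
    have h := ae_pos_tilted hμ l
    rw [← map_eval_div_eq_tilted hμ hτ hl, ae_map_iff (by fun_prop) measurableSet_Ioi] at h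
    exact h
  refine ⟨fun h hh h0 h1 => ⟨lintegral_ofReal_eq_one hμ hf hh h1, fun l hl => ?_⟩,
    fun l hl => ⟨hpair l hl, hpair2 l hl, hpair3 l hl⟩, fun n l hl => ?_, fun l hl => ?_⟩
  · have e1 := lintegral_rlIntegral_eq hμ hν hf hl hh h0
    have hm : Measurable fun p : ℝ × ℝ => ENNReal.ofReal (h (p.1 + p.2)) := by fun_prop
    refine ⟨e1, ?_, ?_⟩
    · rw [e1, ← lintegral_withDensity_pairDensity hν hf hl hh,
        ← (hpair l hl).lintegral_comp hm.aemeasurable]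
    · rw [e1, ← lintegral_withDensity_pairDensity hν hf hl hh,
        ← (hpair3 l hl).lintegral_comp hm.aemeasurable]
      congr 1
      refine lintegral_congr fun ω => ?_
      simp only [Function.comp, tildeS]
      congr 2
      ring
  · have h1 := IsSubordinator.identDistrib_eval_add hτ hτ' hττ' hX hXi
      fun i => (l i ^ α).toNNReal
    have h2 : IdentDistrib (fun ω i => tildeS α τ G (l i) ω)
        (fun ω i => (evalAt τ' G ω + evalAt τ (fun _ => l i ^ α) ω) / l i) P P := by
      have h3 := h1.comp (u := fun (v : Fin n → ℝ) i => v i / l i) (by fun_prop)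
      refine IdentDistrib.trans (IdentDistrib.symm (IdentDistrib.of_ae_eq h3.aemeasurable_fst ?_))
        h3
      filter_upwards [hadd] with ω hω
      ext i
      simp only [Function.comp, tildeS]
      rw [hω _ (hl i)]
    refine ⟨h2, h2.trans ?_⟩
    -- `τ'(G)` has the law of `Gν`, and each is independent of the whole path of `τ`, so one may
    -- replace the other jointly at all times `l i`.
    have h4 : IdentDistrib (fun ω => (evalAt τ' G ω, fun i => evalAt τ (fun _ => l i ^ α) ω))
        (fun ω => (Gν ω, fun i => evalAt τ (fun _ => l i ^ α) ω)) P P :=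
      hElaw.prodMk
        (IdentDistrib.refl (measurable_pi_lambda _ fun i => hτm (l i ^ α).toNNReal).aemeasurable)
        (hEτ.comp (φ := id) (ψ := fun (p : ℝ≥0 → ℝ) i => p (l i ^ α).toNNReal) (by fun_prop)
          (by fun_prop))
        (hGντ.comp (φ := id) (ψ := fun (p : ℝ≥0 → ℝ) i => p (l i ^ α).toNNReal) (by fun_prop)
          (by fun_prop))
    have h5 := h4.comp (u := fun (v : ℝ × (Fin n → ℝ)) i => (v.1 + v.2 i) / l i) (by fun_prop)
    simpa only [Function.comp_def, add_div] using h5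
  · have hlα : 0 < l ^ α := by positivity
    have hsqrt : (l ^ α) ^ (1 / α) = l := by
      rw [← Real.rpow_mul hl.le, mul_one_div_cancel hα0.ne', Real.rpow_one]
    refine ⟨?_, ?_, ?_, ?_⟩
    · filter_upwards [hpos l hl] with ω hω
      have : evalAt τ (fun _ => l ^ α) ω ≠ 0 := fun h => by simp [h] at hω
      rw [tildeS]
      field_simp
    · filter_upwards [hG0] with ω hω
      have h1 : 0 < (G ω + l ^ α) ^ (1 / α) := by positivity
      rw [tildeS, Real.div_rpow (by positivity) hlα.le, hsqrt]
      field_simp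
    -- The first factor is `1 + U / V`, where `(U, V)` has the law of `(Gν, V)` with independent
    -- coordinates.
    · let U : Ω → ℝ := fun ω => evalAt τ (fun ω' => G ω' + l ^ α) ω - evalAt τ (fun _ => l ^ α) ω
      let V : Ω → ℝ := fun ω => evalAt τ (fun _ => l ^ α) ω
      have hUV : IdentDistrib (fun ω => (Gν ω, V ω)) (fun ω => (U ω, V ω)) P P :=
        (hpair' l hl).trans (hincr l hl)
      have hUG : IdentDistrib Gν U P P := hUV.comp measurable_fst
      have hU : AEMeasurable U P := hUG.aemeasurable_snd
      have hV : AEMeasurable V P := (hτm _).aemeasurable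
      have hGν0 : ∀ᵐ ω ∂P, 0 < Gν ω :=
        (hGν.ae_iff (p := fun x => 0 < x) (measurableSet_setOfPred.1 measurableSet_Ioi)).2
          (ae_pos_gammaMeasure _ _)
      have hU0 : ∀ᵐ ω ∂P, 0 < U ω := hUG.ae_snd measurableSet_Ioi hGν0
      have hV0 : ∀ᵐ ω ∂P, 0 < V ω := by
        filter_upwards [hpos l hl] with ω hω using (div_pos_iff_of_pos_right hl).1 hω
      have hUfin : ∫⁻ ω, ENNReal.ofReal (U ω) ∂P < ∞ := by
        have h1 := (hUG.comp ENNReal.measurable_ofReal).lintegral_eq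
        have h2 := lintegral_id_gammaMeasure_lt_top hν
        rw [← hGν.map_eq, lintegral_map' (by fun_prop) hGνm] at h2
        exact h1 ▸ h2
      have hlaw := map_eval_div_eq_tilted hμ hτ hl
      have hVfin : ∫⁻ ω, ENNReal.ofReal (V ω) ∂P < ∞ := by
        have h2 := lintegral_id_tilted_lt_top hμ hl
        rw [← hlaw, lintegral_map' (by fun_prop) (by fun_prop)] at h2
        have h3 : ∀ ω, ENNReal.ofReal (V ω) =
            ENNReal.ofReal l * ENNReal.ofReal (τ (l ^ α).toNNReal ω / l) := fun ω => by
          rw [← ENNReal.ofReal_mul hl.le, mul_div_cancel₀ _ hl.ne']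
          rfl
        simp_rw [h3]
        rw [lintegral_const_mul' _ _ ENNReal.ofReal_ne_top]
        exact ENNReal.mul_lt_top ENNReal.ofReal_lt_top h2
      have hGV : IndepFun Gν V P := hGντ.comp (φ := id)
        (ψ := fun p : ℝ≥0 → ℝ => p (l ^ α).toNNReal) (by fun_prop) (by fun_prop)
      have hconst : ∀ c, ¬ V =ᵐ[P] fun _ => c := by
        intro c hc
        refine not_ae_eq_const_of_map_absolutelyContinuous (P := P)
          (X := fun ω => τ (l ^ α).toNNReal ω / l) ?_ (c / l) ?_
        · rw [hlaw, ← tilted_eq_withDensity hf l]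
          exact withDensity_absolutelyContinuous _ _
        · filter_upwards [hc] with ω hω
          rw [← hω]
          rfl
      intro hi
      refine not_indepFun_div hU hV hU0 hV0 hUfin hVfin (indepFun_of_identDistrib_pair hGV hUV)
        hconst ?_
      refine (hi.comp (φ := fun x => x - 1) (ψ := fun x => x * l) (by fun_prop)
        (by fun_prop)).congr ?_ (ae_of_all _ fun ω => div_mul_cancel₀ _ hl.ne')
      filter_upwards [hV0] with ω hω
      rw [Function.comp, ← div_self hω.ne', ← sub_div]
    · have hH : AEMeasurable (fun ω => (G ω + l ^ α).toNNReal) P := by fun_prop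
      intro hi
      refine not_indepFun_eval_div_rpow hα0 hα1 hτ hH ?_ ?_ ?_ ?_
      · filter_upwards [hG0] with ω hω
        exact Real.toNNReal_pos.2 (by positivity)
      · exact hGτ.comp (φ := fun x => (x + l ^ α).toNNReal) (by fun_prop) measurable_id
      · intro c hc
        refine not_ae_eq_const_of_map_absolutelyContinuous (P := P) (X := G) ?_ (c - l ^ α) ?_
        · rw [hG.map_eq]
          exact withDensity_absolutelyContinuous _ _
        · filter_upwards [hc, hG0] with ω h1 h2
          rw [Real.coe_toNNReal _ (by positivity)] at h1
          rw [← h1, add_sub_cancel_right]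
      -- The map `y ↦ l ^ α * y ^ α` recovers the random time `G + l ^ α` from the second factor, so
      -- independence of the factors would pass to the time.
      · refine (hi.comp (φ := id) (ψ := fun y => (l ^ α * y ^ α).toNNReal) measurable_id
          (by fun_prop)).congr ?_ ?_
        · filter_upwards [hG0] with ω hω
          rw [Function.comp, id, Real.coe_toNNReal _ (by positivity)]
          rfl
        · filter_upwards [hG0] with ω hω
          rw [Function.comp, ← Real.rpow_mul (by positivity), one_div_mul_cancel hα0.ne',
            Real.rpow_one, mul_div_cancel₀ _ hlα.ne']
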